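/- All games are short (finite, loopfree) combinatorial games under normal play, and games are equal, $G=H$, if $G+X$ and $H+X$ have the same outcome for every short game $X$. A number is a game equal to a dyadic rational. The Left and Right stops are defined by $LS(G)=RS(G)=x$ if $G$ equals a number $x$, and otherwise $LS(G)=\max_{G^L}RS(G^L)$ and $RS(G)=\min_{G^R}LS(G^R)$; put $\ell(G)=LS(G)-RS(G)$ (the length of the confusion interval). Two games $G,H$ are infinitesimally close if $LS(G-H)=RS(G-H)=0$. For a dyadic $t\ge -1$, the game $G_t$ ($G$ cooled by $t$) is defined recursively: if $G$ equals an integer $n$, then $G_t=n$; otherwise let $\hat G_t=\{G^L_t-t\mid G^R_t+t\}$ (over all options $G^L$, $G^R$ of $G$), and put $G_t=\hat G_t$ if there is no $s$ with $-1\le s<t$ such that $\hat G_s$ is infinitesimally close to a number, and $G_t=x$ if $s<t$ is the smallest $s\ge -1$ such that $\hat G_s$ is infinitesimally close to a number and $x$ is that number. The temperature $t(G)$ is the smallest $t\ge -1$ such that $G_t$ is infinitesimally close to a number, and $G$ is hot if $t(G)>0$. A thermic version of a hot game $G$ is a game $\widetilde G=\{\widetilde G^L\mid\widetilde G^R\}$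 with exactly one Left option $\widetilde G^L$, which is a Left option of $G$, and exactly one Right option $\widetilde G^R$, which is a Right option of $G$, such that $t(\widetilde G)=t(G)$. For a thermic version $\widetilde G$ of a hot game $G$, let $0=t_0<t_1<\dots<t_k=t(G)$ be $0$, $t(G)$ and, between them, the turning points (points at which the function is not locally affine) of the left wall $t\mapsto LS(\widetilde G_t)$ of the thermograph of $\widetilde G$. Let $T^L_{\mathrm{ver}}$ be the sum of $t_{i+1}-t_i$ over all $i<k$ for which the segment is vertical, i.e. $RS(\widetilde G^L_{t_{i+1}}-t_{i+1})=RS(\widetilde G^L_{t_i}-t_i)$. Define $T^R_{\mathrm{ver}}$ in the same way from the turning points of the right wall $t\mapsto RS(\widetilde G_t)$ and the values $LS(\widetilde G^R_{t_i}+t_i)$. **Theorem.** Let $G$ be a hot short game and $\widetilde G$ a thermic version of $G$. Then $$t(G)\le \ell(H)+\frac{\ell(G)}{2},$$ where $H=\widetilde G^L$ if $T^L_{\mathrm{ver}}\ge T^R_{\mathrm{ver}}$, and $H=\widetilde G^R$ otherwise. -/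

import Mathlib

/-! # Short combinatorial games under normal play: values, stops, cooling, temperature -/

noncomputable section

/-- A short game: finitely many Left options and finitely many Right options. -/
inductive ShortGame : Type
  | mk (m n : ℕ) (L : Fin m → ShortGame) (R : Fin n → ShortGame) : ShortGame

/-- The two players. -/
inductive Player : Type
  | left | right

/-- The four outcome classes: next player wins, previous player wins, Left wins, Right wins. -/
inductive Outcome : Type
  | N | P | L | R

/-- The ring of dyadic rationals `m / 2 ^ k`. -/
def DyadicRat : Subring ℚ where
  carrier := {x | ∃ (m : ℤ) (k : ℕ), x = m / 2 ^ k}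
  mul_mem' := by
    rintro _ _ ⟨m, k, rfl⟩ ⟨m', k', rfl⟩
    exact ⟨m * m', k + k', by push_cast; rw [pow_add]; field_simp⟩
  one_mem' := ⟨1, 0, by norm_num⟩
  add_mem' := by
    rintro _ _ ⟨m, k, rfl⟩ ⟨m', k', rfl⟩
    exact ⟨m * 2 ^ k' + m' * 2 ^ k, k + k', by push_cast; rw [pow_add]; field_simp⟩
  zero_mem' := ⟨0, 0, by norm_num⟩
  neg_mem' := by
    rintro _ ⟨m, k, rfl⟩
    exact ⟨-m, k, by push_cast; ring⟩

namespace ShortGame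

/-! ### Options, negatives and disjunctive sums -/

/-- The game `{A | B}` with a single Left option `A` and a single Right option `B`. -/
def ofPair (A B : ShortGame) : ShortGame := mk 1 1 (fun _ => A) (fun _ => B)

/-- The negative of a game: the roles of the players are exchanged. -/
def neg : ShortGame → ShortGame
  | mk m n L R => mk n m (fun j => neg (R j)) (fun i => neg (L i))

instance : Neg ShortGame := ⟨neg⟩

/-- Auxiliary recursion on the second summand `H`. Here `L i` is the function `X ↦ Gᴸ + X` and `R j`
is the function `X ↦ Gᴿ + X`, for the options of the first summand `G`. -/
def addAux {m n : ℕ} (L : Fin m → ShortGame → ShortGame) (R : Fin n → ShortGame → ShortGame) :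
    ShortGame → ShortGame
  | mk m' n' L' R' =>
      mk (m + m') (n + n')
        (Fin.append (fun i => L i (mk m' n' L' R')) (fun i => addAux L R (L' i)))
        (Fin.append (fun j => R j (mk m' n' L' R')) (fun j => addAux L R (R' j)))

/-- The disjunctive sum. -/
def add : ShortGame → ShortGame → ShortGame
  | mk _ _ L R => addAux (fun i => add (L i)) (fun j => add (R j))

instance : Add ShortGame := ⟨add⟩

instance : Sub ShortGame := ⟨fun G H => G + -H⟩

/-- The recursive formula for the disjunctive sum:
`G + H = {Gᴸ + H, G + Hᴸ | Gᴿ + H, G + Hᴿ}`. -/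
theorem mk_add_mk {m n m' n' : ℕ} (L : Fin m → ShortGame) (R : Fin n → ShortGame)
    (L' : Fin m' → ShortGame) (R' : Fin n' → ShortGame) :
    mk m n L R + mk m' n' L' R' =
      mk (m + m') (n + n')
        (Fin.append (fun i => L i + mk m' n' L' R') (fun i => mk m n L R + L' i))
        (Fin.append (fun j => R j + mk m' n' L' R') (fun j => mk m n L R + R' j)) := rfl

/-! ### Outcomes and equality of games -/

/-- `G.MoverWins p`: player `p`, who is to move in `G`, can force a win under normal play, that is,
`p` has a move to a position in which the opponent, then to move, cannot force a win.
In particular a player who cannot move loses. -/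
def MoverWins : ShortGame → Player → Prop
  | mk _ _ L _, Player.left => ∃ i, ¬ MoverWins (L i) Player.right
  | mk _ _ _ R, Player.right => ∃ j, ¬ MoverWins (R j) Player.left

open Classical in
/-- The outcome class of a game. -/
def outcome (G : ShortGame) : Outcome :=
  if G.MoverWins Player.left then
    if G.MoverWins Player.right then Outcome.N else Outcome.L
  else
    if G.MoverWins Player.right then Outcome.R else Outcome.P

/-- Equality of games (as values): `G` and `H` have the same outcome in every context. -/
def ValueEq (G H : ShortGame) : Prop :=
  ∀ X : ShortGame, outcome (G + X) = outcome (H + X)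

/-! ### Numbers -/

/-- The games `0 = {|}` and `n + 1 = {n |}`. -/
def natForm : ℕ → ShortGame
  | 0 => mk 0 0 Fin.elim0 Fin.elim0
  | n + 1 => mk 1 0 (fun _ => natForm n) Fin.elim0

/-- The integer `m` as a game. -/
def intForm : ℤ → ShortGame
  | Int.ofNat n => natForm n
  | Int.negSucc n => -natForm (n + 1)

/-- The dyadic rational `m / 2 ^ k` as a game. It is the integer `m` if `k = 0`; if `m` is even the
fraction is reduced; and if `m` is odd and `k > 0` it is `{(m - 1) / 2 ^ k | (m + 1) / 2 ^ k}`. -/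
def dyadicForm : ℤ → ℕ → ShortGame
  | m, 0 => intForm m
  | m, k + 1 =>
      if Even m then dyadicForm (m / 2) k
      else ofPair (dyadicForm ((m - 1) / 2) k) (dyadicForm ((m + 1) / 2) k)

/-- The number `x` as a game. The denominator of `x` is a power of two. -/
def num (x : DyadicRat) : ShortGame := dyadicForm (x : ℚ).num (Nat.log 2 (x : ℚ).den)

/-! ### Stops -/

/-- The maximum of a nonempty finite family (`0` for the empty family). -/
def maxOf {m : ℕ} (f : Fin m → ℚ) : ℚ :=
  if h : (Finset.univ : Finset (Fin m)).Nonempty then Finset.univ.sup' h f else 0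

/-- The minimum of a nonempty finite family (`0` for the empty family). -/
def minOf {m : ℕ} (f : Fin m → ℚ) : ℚ :=
  if h : (Finset.univ : Finset (Fin m)).Nonempty then Finset.univ.inf' h f else 0

open Classical in
/-- The Left stop (`p = left`) and the Right stop (`p = right`) of a game. A game in which one of the
players has no option is equal to an integer, so only nonempty families occur in the last cases. -/
def stopValue : ShortGame → Player → ℚ
  | mk m n L R, p =>
      if h : ∃ x : DyadicRat, ValueEq (mk m n L R) (num x) then (h.choose : ℚ)
      else match p with
        | Player.left => maxOf (fun i => stopValue (L i) Player.right)
        | Player.right => minOf (fun j => stopValue (R j) Player.left)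

/-- The Left stop. -/
def LS (G : ShortGame) : ℚ := G.stopValue Player.left

/-- The Right stop. -/
def RS (G : ShortGame) : ℚ := G.stopValue Player.right

/-- The length `ℓ(G)` of the confusion interval of `G`. -/
def ell (G : ShortGame) : ℚ := G.LS - G.RS

/-- `G` and `H` are infinitesimally close. -/
def InfClose (G H : ShortGame) : Prop := (G - H).LS = 0 ∧ (G - H).RS = 0

/-! ### Cooling and temperature -/

open Classical in
/-- One step in the definition of cooling, for a game `G` and the family `T` of the games
`T t = {Gᴸ_t - t | Gᴿ_t + t}`. If `G` is equal to an integer `n`, then `G` cooled by `t` is `n`. If not,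
and if `s` is the least `s ≥ -1` for which `T s` is infinitesimally close to a number `x`, then
`G` cooled by `t` is `x` when `s < t`, and is `T t` otherwise. -/
def coolStep (G : ShortGame) (T : DyadicRat → ShortGame) (t : DyadicRat) : ShortGame :=
  if h : ∃ n : ℤ, ValueEq G (intForm n) then intForm h.choose
  else if h : ∃ x s : DyadicRat,
      IsLeast {r : DyadicRat | -1 ≤ r ∧ ∃ y, InfClose (T r) (num y)} s ∧ s < t ∧
        InfClose (T s) (num x) then
    num h.choose
  else T t

/-- `G.cool t` is `G` cooled by `t` (for `t ≥ -1`). -/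
def cool : ShortGame → DyadicRat → ShortGame
  | mk m n L R =>
      coolStep (mk m n L R) (fun t =>
        mk m n (fun i => cool (L i) t - num t) (fun j => cool (R j) t + num t))

/-- `t` is the smallest `t ≥ -1` such that `G` cooled by `t` is infinitesimally close to a number. -/
def IsTemp (G : ShortGame) (t : DyadicRat) : Prop :=
  IsLeast {t : DyadicRat | -1 ≤ t ∧ ∃ x, InfClose (G.cool t) (num x)} t

open Classical in
/-- The temperature of a game: the `t` with `IsTemp G t`. The default `-1` is not positive, so a game whose
temperature is positive has a temperature in the sense of `IsTemp`. -/
def temp (G : ShortGame) : DyadicRat :=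
  if h : ∃ t, IsTemp G t then h.choose else -1

/-- A game is hot if its temperature is positive. -/
def Hot (G : ShortGame) : Prop := 0 < G.temp

/-- `(A, B)` is a pair of thermic options of `G`: `A` is a Left option of `G`, `B` is a Right option
of `G`, and `{A | B}`, the corresponding thermic version of `G`, has the temperature of `G`. -/
def IsThermicPair : ShortGame → ShortGame → ShortGame → Prop
  | mk m n L R, A, B =>
      (∃ i, A = L i) ∧ (∃ j, B = R j) ∧ temp (ofPair A B) = temp (mk m n L R)

/-! ### Walls of the thermograph and the lengths of their vertical segments -/

/-- `t` is a turning point of `f`: there is no neighbourhood of `t` on which `f` is affine. -/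
def IsTurningPoint (f : DyadicRat → ℚ) (t : DyadicRat) : Prop :=
  ¬ ∃ ε : ℚ, 0 < ε ∧ ∃ c : ℚ, ∀ s : DyadicRat,
    |(s : ℚ) - (t : ℚ)| < ε → f s = f t + c * ((s : ℚ) - (t : ℚ))

/-- The points `0` and `b` together with all turning points of `f` strictly between them. -/
def turningSet (f : DyadicRat → ℚ) (b : DyadicRat) : Set DyadicRat :=
  {t | t = 0 ∨ t = b ∨ (0 < t ∧ t < b ∧ IsTurningPoint f t)}

open Classical in
/-- The increasing sequence `0 = t₀ < t₁ < … < tₖ = b` of the elements of `turningSet f b`. -/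
def turningList (f : DyadicRat → ℚ) (b : DyadicRat) : List DyadicRat :=
  if h : (turningSet f b).Finite then h.toFinset.sort (· ≤ ·) else []

open Classical in
/-- For a sequence `t₀ < t₁ < … < tₖ`, the sum of `tᵢ₊₁ - tᵢ` over all `i` with
`g tᵢ₊₁ = g tᵢ`. -/
def verticalSum (g : DyadicRat → ℚ) (l : List DyadicRat) : ℚ :=
  ((l.zip l.tail).map fun p => if g p.2 = g p.1 then (p.2 : ℚ) - (p.1 : ℚ) else 0).sum

/-- The total length, between `0` and the temperature, of the vertical segments of the left wall
`t ↦ LS(G_t)` of the thermograph of `G = {A | B}`, where a segment from `tᵢ` to `tᵢ₊₁` is vertical if the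
Right stops of `A_{tᵢ} - tᵢ` and `A_{tᵢ₊₁} - tᵢ₊₁` agree. -/
def leftVertical (A B : ShortGame) : ℚ :=
  verticalSum (fun t => (A.cool t - num t).RS)
    (turningList (fun t => ((ofPair A B).cool t).LS) (ofPair A B).temp)

/-- The total length, between `0` and the temperature, of the vertical segments of the right wall
`t ↦ RS(G_t)` of the thermograph of `G = {A | B}`, where a segment from `tᵢ` to `tᵢ₊₁` is vertical if the
Left stops of `B_{tᵢ} + tᵢ` and `B_{tᵢ₊₁} + tᵢ₊₁` agree. -/
def rightVertical (A B : ShortGame) : ℚ :=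
  verticalSum (fun t => (B.cool t + num t).LS)
    (turningList (fun t => ((ofPair A B).cool t).RS) (ofPair A B).temp)

end ShortGame

end

noncomputable section

namespace ShortGame

/-! ### Options -/

/-! Write T for t(G) and {A | B} for the thermic version. Up to temperature T the walls of its
thermograph are l(t) = RS(A_t) - t and r(t) = LS(B_t) + t (`walls_ofPair`). The left wall has slopes
-1 and 0 in t, so its vertical length is T minus its total descent, that is T + l(T) - l(0) =
RS(A_T) - RS(A) (`leftVertical_eq`). Left walls never rise, so this is at most LS(A_T) - RS(A) ≤
ℓ(A). Symmetrically the right vertical length LS(B) - LS(B_T) is at most ℓ(B).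

The walls meet at T, so the two lengths add up to 2T - (RS(A) - LS(B)). Since A and B are options of
G, which is not a number, RS(A) ≤ LS(G) and RS(G) ≤ LS(B). Hence the larger length is at least T -
ℓ(G)/2, and it is at most ℓ(H).

Two facts carry the weight. The first is the shape of thermographs: left walls have slopes -1 and 0,
right walls 0 and 1, and all breaks lie on a dyadic grid, so that the least meeting point demanded
by the definition of cooling exists among the dyadics whenever the scaffolds meet. `GridAffine`
records this; it survives maxima, minima, the tax ±t and the drawing of a mast (`GridAffine.max`,
`GridAffine.crossing`, `GridAffine.freeze`), which gives `exists_walls_gridAffine` by induction and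
the description `walls_cases` of cooling.

The second is that cooling by zero preserves both stops (`walls_zero`). Cooling starts at -1, and a
mast planted below zero could freeze wrong values; `isNumber_of_mast_neg` shows that this happens
only for numbers. It rests on the fact that cooling by t with -1/2^k ≤ t ≤ 0 keeps lower and upper
bounds that are multiples of 1/2^k (`le_rightWall_of_num_le`, `leftWall_le_of_le_num`).

Underneath lies the classical theory: the ordered group of values, the simplicity theorem
`isNumber_of_fits`, and the comparison of games with numbers through stops, `stops_spec`. -/

/-- `X` is a Left option of the given game. -/
def IsL (X : ShortGame) : ShortGame → Prop
  | mk _ _ L _ => ∃ i, L i = X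

/-- `X` is a Right option of the given game. -/
def IsR (X : ShortGame) : ShortGame → Prop
  | mk _ _ _ R => ∃ j, R j = X

theorem isL_apply {m n : ℕ} (L : Fin m → ShortGame) (R : Fin n → ShortGame) (i : Fin m) :
    IsL (L i) (mk m n L R) := ⟨i, rfl⟩

theorem isR_apply {m n : ℕ} (L : Fin m → ShortGame) (R : Fin n → ShortGame) (j : Fin n) :
    IsR (R j) (mk m n L R) := ⟨j, rfl⟩

theorem option_induction {P : ShortGame → Prop}
    (h : ∀ G, (∀ X, IsL X G → P X) → (∀ X, IsR X G → P X) → P G) (G : ShortGame) : P G := by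
  induction G with
  | mk m n L R ihL ihR =>
    apply h
    · rintro _ ⟨i, rfl⟩
      exact ihL i
    · rintro _ ⟨j, rfl⟩
      exact ihR j

theorem isL_add {X G H : ShortGame} :
    IsL X (G + H) ↔ (∃ G', IsL G' G ∧ X = G' + H) ∨ ∃ H', IsL H' H ∧ X = G + H' := by
  obtain ⟨m, n, L, R⟩ := G
  obtain ⟨m', n', L', R'⟩ := H
  rw [mk_add_mk]
  constructor
  · rintro ⟨i, rfl⟩
    refine Fin.addCases (fun i => ?_) (fun i => ?_) i
    · exact Or.inl ⟨L i, ⟨i, rfl⟩, by simp⟩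
    · exact Or.inr ⟨L' i, ⟨i, rfl⟩, by simp⟩
  · rintro (⟨_, ⟨i, rfl⟩, rfl⟩ | ⟨_, ⟨i, rfl⟩, rfl⟩)
    · exact ⟨Fin.castAdd _ i, by simp⟩
    · exact ⟨Fin.natAdd _ i, by simp⟩

theorem isR_add {X G H : ShortGame} :
    IsR X (G + H) ↔ (∃ G', IsR G' G ∧ X = G' + H) ∨ ∃ H', IsR H' H ∧ X = G + H' := by
  obtain ⟨m, n, L, R⟩ := G
  obtain ⟨m', n', L', R'⟩ := H
  rw [mk_add_mk]
  constructor
  · rintro ⟨i, rfl⟩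
    refine Fin.addCases (fun i => ?_) (fun i => ?_) i
    · exact Or.inl ⟨R i, ⟨i, rfl⟩, by simp⟩
    · exact Or.inr ⟨R' i, ⟨i, rfl⟩, by simp⟩
  · rintro (⟨_, ⟨i, rfl⟩, rfl⟩ | ⟨_, ⟨i, rfl⟩, rfl⟩)
    · exact ⟨Fin.castAdd _ i, by simp⟩
    · exact ⟨Fin.natAdd _ i, by simp⟩

theorem isL_neg {X G : ShortGame} : IsL X (-G) ↔ ∃ Y, IsR Y G ∧ X = -Y := by
  obtain ⟨m, n, L, R⟩ := G
  constructor
  · rintro ⟨i, rfl⟩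
    exact ⟨R i, ⟨i, rfl⟩, rfl⟩
  · rintro ⟨_, ⟨i, rfl⟩, rfl⟩
    exact ⟨i, rfl⟩

theorem isR_neg {X G : ShortGame} : IsR X (-G) ↔ ∃ Y, IsL Y G ∧ X = -Y := by
  obtain ⟨m, n, L, R⟩ := G
  constructor
  · rintro ⟨i, rfl⟩
    exact ⟨L i, ⟨i, rfl⟩, rfl⟩
  · rintro ⟨_, ⟨i, rfl⟩, rfl⟩
    exact ⟨i, rfl⟩

theorem isL_ofPair {X A B : ShortGame} : IsL X (ofPair A B) ↔ X = A :=
  ⟨fun ⟨_, h⟩ => h.symm, fun h => ⟨0, h.symm⟩⟩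

theorem isR_ofPair {X A B : ShortGame} : IsR X (ofPair A B) ↔ X = B :=
  ⟨fun ⟨_, h⟩ => h.symm, fun h => ⟨0, h.symm⟩⟩

instance : Zero ShortGame := ⟨natForm 0⟩

theorem not_isL_zero {X : ShortGame} : ¬ IsL X 0 := fun ⟨i, _⟩ => i.elim0

theorem not_isR_zero {X : ShortGame} : ¬ IsR X 0 := fun ⟨i, _⟩ => i.elim0

/-! ### The partial order -/

/-- Auxiliary recursion on the second game for `lePair`. -/
def leAux {m n : ℕ} (L : Fin m → ShortGame → Prop × Prop) (R : Fin n → ShortGame → Prop × Prop) :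
    ShortGame → Prop × Prop
  | mk m' n' L' R' =>
      ((∀ i, ¬ (L i (mk m' n' L' R')).2) ∧ ∀ j, ¬ (leAux L R (R' j)).2,
        (∀ i, ¬ (leAux L R (L' i)).1) ∧ ∀ j, ¬ (R j (mk m' n' L' R')).1)

/-- The pair of propositions `G ≤ H` and `H ≤ G`. -/
def lePair : ShortGame → ShortGame → Prop × Prop
  | mk _ _ L R => leAux (fun i => lePair (L i)) (fun j => lePair (R j))

/-- The two components come from one structural recursion, in which each unfolds into the other at
the options. Their agreement under exchange of arguments leaves a single relation, as `le_iff`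
needs. -/
theorem lePair_swap (G : ShortGame) : ∀ H, (lePair G H).2 = (lePair H G).1 := by
  suffices h : ∀ H, (lePair G H).2 = (lePair H G).1 ∧ (lePair G H).1 = (lePair H G).2 from
    fun H => (h H).1
  induction G with
  | mk m n L R ihL ihR =>
    intro H
    induction H with
    | mk m' n' L' R' ihL' ihR' =>
      constructor
      · change ((∀ i, ¬ (lePair (mk m n L R) (L' i)).1) ∧
          ∀ j, ¬ (lePair (R j) (mk m' n' L' R')).1) =
          ((∀ i, ¬ (lePair (L' i) (mk m n L R)).2) ∧
          ∀ j, ¬ (lePair (mk m' n' L' R') (R j)).2)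
        simp only [(ihL' _).2, (ihR _ _).2]
      · change ((∀ i, ¬ (lePair (L i) (mk m' n' L' R')).2) ∧
          ∀ j, ¬ (lePair (mk m n L R) (R' j)).2) =
          ((∀ i, ¬ (lePair (mk m' n' L' R') (L i)).1) ∧
          ∀ j, ¬ (lePair (R' j) (mk m n L R)).1)
        simp only [(ihL _ _).1, (ihR' _).1]

instance : LE ShortGame := ⟨fun G H => (lePair G H).1⟩

theorem le_iff {G H : ShortGame} :
    G ≤ H ↔ (∀ X, IsL X G → ¬ H ≤ X) ∧ ∀ Y, IsR Y H → ¬ Y ≤ G := by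
  obtain ⟨m, n, L, R⟩ := G
  obtain ⟨m', n', L', R'⟩ := H
  change ((∀ i, ¬ (lePair (L i) (mk m' n' L' R')).2) ∧
    ∀ j, ¬ (lePair (mk m n L R) (R' j)).2) ↔ _
  simp only [lePair_swap]
  constructor
  · rintro ⟨h1, h2⟩
    refine ⟨?_, ?_⟩
    · rintro _ ⟨i, rfl⟩
      exact h1 i
    · rintro _ ⟨i, rfl⟩
      exact h2 i
  · rintro ⟨h1, h2⟩
    exact ⟨fun i => h1 _ ⟨i, rfl⟩, fun j => h2 _ ⟨j, rfl⟩⟩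

theorem not_le_iff {G H : ShortGame} :
    ¬ G ≤ H ↔ (∃ X, IsL X G ∧ H ≤ X) ∨ ∃ Y, IsR Y H ∧ Y ≤ G := by
  rw [le_iff]
  by_cases h1 : ∃ X, IsL X G ∧ H ≤ X
  · simp only [h1, true_or, iff_true]
    obtain ⟨X, hX, h⟩ := h1
    exact fun h' => h'.1 X hX h
  · by_cases h2 : ∃ Y, IsR Y H ∧ Y ≤ G
    · simp only [h2, or_true, iff_true]
      obtain ⟨X, hX, h⟩ := h2
      exact fun h' => h'.2 X hX h
    · simp only [h1, h2, or_self, iff_false, not_not]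
      push Not at h1 h2
      exact ⟨h1, h2⟩

theorem le_rfl' (G : ShortGame) : G ≤ G := by
  induction G using option_induction with
  | h G ihL ihR =>
    exact le_iff.2 ⟨fun X hX h => (le_iff.1 h).1 X hX (ihL X hX),
      fun Y hY h => (le_iff.1 h).2 Y hY (ihR Y hY)⟩

/-- If G ≤ H ≤ K and K ≤ X for a Left option X of G, then H ≤ K ≤ X is a transitivity instance for a
rotated triple with one game replaced by an option. Hence all three rotations go into one induction.
-/
theorem le_trans_rotations (G H K : ShortGame) :
    (G ≤ H → H ≤ K → G ≤ K) ∧ (H ≤ K → K ≤ G → H ≤ G) ∧ (K ≤ G → G ≤ H → K ≤ H) := by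
  have key : ∀ G H K : ShortGame, (∀ X, IsL X G → H ≤ K → K ≤ X → H ≤ X) →
      (∀ X, IsR X K → X ≤ G → G ≤ H → X ≤ H) → G ≤ H → H ≤ K → G ≤ K := by
    intro G H K h1 h2 hGH hHK
    refine le_iff.2 ⟨fun X hX h => ?_, fun Y hY h => ?_⟩
    · exact (le_iff.1 hGH).1 X hX (h1 X hX hHK h)
    · exact (le_iff.1 hHK).2 Y hY (h2 Y hY h hGH)
  induction G using option_induction generalizing H K with
  | h G ihGL ihGR =>
  induction H using option_induction generalizing K with
  | h H ihHL ihHR =>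
  induction K using option_induction with
  | h K ihKL ihKR =>
    refine ⟨key _ _ _ (fun X hX => (ihGL X hX H K).2.1) (fun X hX => (ihKR X hX).2.2),
      key _ _ _ (fun X hX => (ihHL X hX K).2.2) (fun X hX => (ihGR X hX H K).1),
      key _ _ _ (fun X hX => (ihKL X hX).1) (fun X hX => (ihHR X hX K).2.1)⟩

instance : Preorder ShortGame where
  le_refl := le_rfl'
  le_trans G H K := (le_trans_rotations G H K).1

theorem not_le_of_isL {X G : ShortGame} (h : IsL X G) : ¬ G ≤ X :=
  (le_iff.1 (le_refl G)).1 X h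

theorem not_le_of_isR {X G : ShortGame} (h : IsR X G) : ¬ X ≤ G :=
  (le_iff.1 (le_refl G)).2 X h

/-! ### Compatibility of the order with sums and negatives -/

/-- A move in G or H calls for cancellation at the options and a move in K for monotonicity, with
the roles of G and H exchanged on the way. So both implications, for both orders, are proved
together. -/
theorem add_le_add_right_iff (G H K : ShortGame) : G + K ≤ H + K ↔ G ≤ H := by
  suffices h : (G + K ≤ H + K ↔ G ≤ H) ∧ (H + K ≤ G + K ↔ H ≤ G) from h.1
  have key : ∀ G H K : ShortGame,
      (∀ X, IsL X G → (H + K ≤ X + K ↔ H ≤ X)) → (∀ X, IsR X H → (X + K ≤ G + K ↔ X ≤ G)) →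
      (∀ X, IsL X K → (G + X ≤ H + X ↔ G ≤ H)) → (∀ X, IsR X K → (G + X ≤ H + X ↔ G ≤ H)) →
      (G + K ≤ H + K ↔ G ≤ H) := by
    intro G H K h1 h2 h3 h4
    constructor
    · intro h
      rw [le_iff] at h ⊢
      refine ⟨fun X hX hle => ?_, fun X hX hle => ?_⟩
      · exact h.1 (X + K) (isL_add.2 (Or.inl ⟨X, hX, rfl⟩)) ((h1 X hX).2 hle)
      · exact h.2 (X + K) (isR_add.2 (Or.inl ⟨X, hX, rfl⟩)) ((h2 X hX).2 hle)
    · intro h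
      rw [le_iff]
      refine ⟨fun X hX hle => ?_, fun X hX hle => ?_⟩
      · rcases isL_add.1 hX with ⟨G', hG', rfl⟩ | ⟨K', hK', rfl⟩
        · exact (le_iff.1 h).1 G' hG' ((h1 G' hG').1 hle)
        · exact not_le_of_isL (isL_add.2 (Or.inr ⟨K', hK', rfl⟩))
            (hle.trans ((h3 K' hK').2 h))
      · rcases isR_add.1 hX with ⟨G', hG', rfl⟩ | ⟨K', hK', rfl⟩
        · exact (le_iff.1 h).2 G' hG' ((h2 G' hG').1 hle)
        · exact not_le_of_isR (isR_add.2 (Or.inr ⟨K', hK', rfl⟩))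
            (((h4 K' hK').2 h).trans hle)
  induction G using option_induction generalizing H K with
  | h G ihGL ihGR =>
  induction H using option_induction generalizing K with
  | h H ihHL ihHR =>
  induction K using option_induction with
  | h K ihKL ihKR =>
    exact ⟨key G H K (fun X hX => (ihGL X hX H K).2) (fun X hX => (ihHR X hX K).2)
        (fun X hX => (ihKL X hX).1) (fun X hX => (ihKR X hX).1),
      key H G K (fun X hX => (ihHL X hX K).1) (fun X hX => (ihGR X hX H K).1)
        (fun X hX => (ihKL X hX).2) (fun X hX => (ihKR X hX).2)⟩

theorem add_comm_le (G H : ShortGame) : G + H ≤ H + G := by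
  induction G using option_induction generalizing H with
  | h G ihGL ihGR =>
  induction H using option_induction with
  | h H ihHL ihHR =>
    refine le_iff.2 ⟨fun X hX hle => ?_, fun X hX hle => ?_⟩
    · rcases isL_add.1 hX with ⟨G', hG', rfl⟩ | ⟨K', hK', rfl⟩
      · exact not_le_of_isL (isL_add.2 (Or.inr ⟨G', hG', rfl⟩)) (hle.trans (ihGL G' hG' H))
      · exact not_le_of_isL (isL_add.2 (Or.inl ⟨K', hK', rfl⟩)) (hle.trans (ihHL K' hK'))
    · rcases isR_add.1 hX with ⟨K', hK', rfl⟩ | ⟨G', hG', rfl⟩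
      · exact not_le_of_isR (isR_add.2 (Or.inr ⟨K', hK', rfl⟩)) ((ihHR K' hK').trans hle)
      · exact not_le_of_isR (isR_add.2 (Or.inl ⟨G', hG', rfl⟩)) ((ihGR G' hG' H).trans hle)

theorem add_assoc_le_le (G H K : ShortGame) :
    G + H + K ≤ G + (H + K) ∧ G + (H + K) ≤ G + H + K := by
  induction G using option_induction generalizing H K with
  | h G ihGL ihGR =>
  induction H using option_induction generalizing K with
  | h H ihHL ihHR =>
  induction K using option_induction with
  | h K ihKL ihKR =>
    refine ⟨le_iff.2 ⟨fun X hX hle => ?_, fun X hX hle => ?_⟩,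
      le_iff.2 ⟨fun X hX hle => ?_, fun X hX hle => ?_⟩⟩
    · rcases isL_add.1 hX with ⟨Y, hY, rfl⟩ | ⟨K', hK', rfl⟩
      · rcases isL_add.1 hY with ⟨G', hG', rfl⟩ | ⟨H', hH', rfl⟩
        · exact not_le_of_isL (isL_add.2 (Or.inl ⟨G', hG', rfl⟩)) (hle.trans (ihGL G' hG' H K).1)
        · exact not_le_of_isL (isL_add.2 (Or.inr ⟨_, isL_add.2 (Or.inl ⟨H', hH', rfl⟩), rfl⟩))
            (hle.trans (ihHL H' hH' K).1)
      · exact not_le_of_isL (isL_add.2 (Or.inr ⟨_, isL_add.2 (Or.inr ⟨K', hK', rfl⟩), rfl⟩))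
          (hle.trans (ihKL K' hK').1)
    · rcases isR_add.1 hX with ⟨G', hG', rfl⟩ | ⟨Y, hY, rfl⟩
      · exact not_le_of_isR (isR_add.2 (Or.inl ⟨_, isR_add.2 (Or.inl ⟨G', hG', rfl⟩), rfl⟩))
          ((ihGR G' hG' H K).1.trans hle)
      · rcases isR_add.1 hY with ⟨H', hH', rfl⟩ | ⟨K', hK', rfl⟩
        · exact not_le_of_isR (isR_add.2 (Or.inl ⟨_, isR_add.2 (Or.inr ⟨H', hH', rfl⟩), rfl⟩))
            ((ihHR H' hH' K).1.trans hle)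
        · exact not_le_of_isR (isR_add.2 (Or.inr ⟨K', hK', rfl⟩)) ((ihKR K' hK').1.trans hle)
    · rcases isL_add.1 hX with ⟨G', hG', rfl⟩ | ⟨Y, hY, rfl⟩
      · exact not_le_of_isL (isL_add.2 (Or.inl ⟨_, isL_add.2 (Or.inl ⟨G', hG', rfl⟩), rfl⟩))
          (hle.trans (ihGL G' hG' H K).2)
      · rcases isL_add.1 hY with ⟨H', hH', rfl⟩ | ⟨K', hK', rfl⟩
        · exact not_le_of_isL (isL_add.2 (Or.inl ⟨_, isL_add.2 (Or.inr ⟨H', hH', rfl⟩), rfl⟩))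
            (hle.trans (ihHL H' hH' K).2)
        · exact not_le_of_isL (isL_add.2 (Or.inr ⟨K', hK', rfl⟩)) (hle.trans (ihKL K' hK').2)
    · rcases isR_add.1 hX with ⟨Y, hY, rfl⟩ | ⟨K', hK', rfl⟩
      · rcases isR_add.1 hY with ⟨G', hG', rfl⟩ | ⟨H', hH', rfl⟩
        · exact not_le_of_isR (isR_add.2 (Or.inl ⟨G', hG', rfl⟩)) ((ihGR G' hG' H K).2.trans hle)
        · exact not_le_of_isR (isR_add.2 (Or.inr ⟨_, isR_add.2 (Or.inl ⟨H', hH', rfl⟩), rfl⟩))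
            ((ihHR H' hH' K).2.trans hle)
      · exact not_le_of_isR (isR_add.2 (Or.inr ⟨_, isR_add.2 (Or.inr ⟨K', hK', rfl⟩), rfl⟩))
          ((ihKR K' hK').2.trans hle)

theorem add_zero_le_le (G : ShortGame) : G + 0 ≤ G ∧ G ≤ G + 0 := by
  induction G using option_induction with
  | h G ihL ihR =>
    refine ⟨le_iff.2 ⟨fun X hX hle => ?_, fun X hX hle => ?_⟩,
      le_iff.2 ⟨fun X hX hle => ?_, fun X hX hle => ?_⟩⟩
    · rcases isL_add.1 hX with ⟨G', hG', rfl⟩ | ⟨K', hK', rfl⟩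
      · exact not_le_of_isL hG' (hle.trans (ihL G' hG').1)
      · exact not_isL_zero hK'
    · exact not_le_of_isR (isR_add.2 (Or.inl ⟨X, hX, rfl⟩)) ((ihR X hX).1.trans hle)
    · exact not_le_of_isL (isL_add.2 (Or.inl ⟨X, hX, rfl⟩)) (hle.trans (ihL X hX).2)
    · rcases isR_add.1 hX with ⟨G', hG', rfl⟩ | ⟨K', hK', rfl⟩
      · exact not_le_of_isR hG' ((ihR G' hG').2.trans hle)
      · exact not_isR_zero hK'

/-- The mirror strategy: every move in one component is answered by its negative in the other. -/
theorem add_neg_le_le (G : ShortGame) : G + -G ≤ 0 ∧ 0 ≤ G + -G := by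
  induction G using option_induction with
  | h G ihL ihR =>
    refine ⟨le_iff.2 ⟨fun X hX hle => ?_, fun X hX => (not_isR_zero hX).elim⟩,
      le_iff.2 ⟨fun X hX => (not_isL_zero hX).elim, fun X hX hle => ?_⟩⟩
    · rcases isL_add.1 hX with ⟨G', hG', rfl⟩ | ⟨K', hK', rfl⟩
      · exact (le_iff.1 hle).2 (G' + -G')
          (isR_add.2 (Or.inr ⟨_, isR_neg.2 ⟨G', hG', rfl⟩, rfl⟩)) (ihL G' hG').1
      · obtain ⟨Y, hY, rfl⟩ := isL_neg.1 hK'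
        exact (le_iff.1 hle).2 (Y + -Y) (isR_add.2 (Or.inl ⟨Y, hY, rfl⟩)) (ihR Y hY).1
    · rcases isR_add.1 hX with ⟨G', hG', rfl⟩ | ⟨K', hK', rfl⟩
      · exact (le_iff.1 hle).1 (G' + -G')
          (isL_add.2 (Or.inr ⟨_, isL_neg.2 ⟨G', hG', rfl⟩, rfl⟩)) (ihR G' hG').2
      · obtain ⟨Y, hY, rfl⟩ := isR_neg.1 hK'
        exact (le_iff.1 hle).1 (Y + -Y) (isL_add.2 (Or.inl ⟨Y, hY, rfl⟩)) (ihL Y hY).2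

theorem neg_le_neg_of_le {G H : ShortGame} (h : G ≤ H) : -H ≤ -G := by
  have key : ∀ G H : ShortGame, (∀ X, IsR X H → (-G ≤ -X ↔ X ≤ G)) →
      (∀ X, IsL X G → (-X ≤ -H ↔ H ≤ X)) → (-H ≤ -G ↔ G ≤ H) := by
    intro G H h1 h2
    rw [le_iff, le_iff (G := G)]
    constructor
    · rintro ⟨h3, h4⟩
      exact ⟨fun X hX hle => h4 _ (isR_neg.2 ⟨X, hX, rfl⟩) ((h2 X hX).2 hle),
        fun X hX hle => h3 _ (isL_neg.2 ⟨X, hX, rfl⟩) ((h1 X hX).2 hle)⟩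
    · rintro ⟨h3, h4⟩
      refine ⟨fun X hX hle => ?_, fun X hX hle => ?_⟩
      · obtain ⟨Y, hY, rfl⟩ := isL_neg.1 hX
        exact h4 Y hY ((h1 Y hY).1 hle)
      · obtain ⟨Y, hY, rfl⟩ := isR_neg.1 hX
        exact h3 Y hY ((h2 Y hY).1 hle)
  have main : ∀ G H : ShortGame, (-H ≤ -G ↔ G ≤ H) ∧ (-G ≤ -H ↔ H ≤ G) := by
    intro G
    induction G using option_induction with
    | h G ihGL ihGR =>
    intro H
    induction H using option_induction with
    | h H ihHL ihHR =>
      exact ⟨key G H (fun X hX => (ihHR X hX).2) (fun X hX => (ihGL X hX H).2),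
        key H G (fun X hX => (ihGR X hX H).1) (fun X hX => (ihHL X hX).1)⟩
  exact (main G H).1.2 h

theorem add_comm_antisymmRel (G H : ShortGame) : AntisymmRel (· ≤ ·) (G + H) (H + G) :=
  ⟨add_comm_le G H, add_comm_le H G⟩

theorem add_le_add_of_le {G G' H H' : ShortGame} (h : G ≤ G') (h' : H ≤ H') :
    G + H ≤ G' + H' :=
  ((add_le_add_right_iff _ _ _).2 h).trans <| (add_comm_le _ _).trans <|
    ((add_le_add_right_iff _ _ _).2 h').trans (add_comm_le _ _)

/-! ### The ordered group of values -/

/-- The values of games: games modulo equality. -/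
abbrev Val : Type := Antisymmetrization ShortGame (· ≤ ·)

/-- The value of a game. -/
def val (G : ShortGame) : Val := toAntisymmetrization (· ≤ ·) G

theorem val_le {G H : ShortGame} : val G ≤ val H ↔ G ≤ H := Iff.rfl

theorem val_eq {G H : ShortGame} : val G = val H ↔ G ≤ H ∧ H ≤ G := by
  rw [le_antisymm_iff, val_le, val_le]

instance : Add Val :=
  ⟨Quotient.map₂ (· + ·) fun _ _ h _ _ h' =>
    ⟨add_le_add_of_le h.1 h'.1, add_le_add_of_le h.2 h'.2⟩⟩

instance : Neg Val :=
  ⟨Quotient.map (- ·) fun _ _ h => ⟨neg_le_neg_of_le h.2, neg_le_neg_of_le h.1⟩⟩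

instance : Zero Val := ⟨val 0⟩

theorem val_add (G H : ShortGame) : val (G + H) = val G + val H := rfl

theorem val_neg (G : ShortGame) : val (-G) = -val G := rfl

theorem val_zero : val 0 = 0 := rfl

theorem val_surjective (v : Val) : ∃ G, val G = v := Quotient.exists_rep v

/-- The group laws fail for the games themselves, whose options are ordered lists, but hold for
values; there the general theory of ordered groups applies. -/
instance : AddCommGroup Val where
  add_assoc a b c := by
    obtain ⟨G, rfl⟩ := val_surjective a
    obtain ⟨H, rfl⟩ := val_surjective b
    obtain ⟨K, rfl⟩ := val_surjective c
    exact val_eq.2 (add_assoc_le_le G H K)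
  add_comm a b := by
    obtain ⟨G, rfl⟩ := val_surjective a
    obtain ⟨H, rfl⟩ := val_surjective b
    exact val_eq.2 (add_comm_antisymmRel G H)
  add_zero a := by
    obtain ⟨G, rfl⟩ := val_surjective a
    exact val_eq.2 (add_zero_le_le G)
  zero_add a := by
    obtain ⟨G, rfl⟩ := val_surjective a
    exact (val_eq.2 (add_comm_antisymmRel 0 G)).trans (val_eq.2 (add_zero_le_le G))
  neg_add_cancel a := by
    obtain ⟨G, rfl⟩ := val_surjective a
    exact (val_eq.2 (add_comm_antisymmRel (-G) G)).trans (val_eq.2 (add_neg_le_le G))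
  nsmul := nsmulRec
  zsmul := zsmulRec

instance : IsOrderedAddMonoid Val where
  add_le_add_left a b h c := by
    obtain ⟨G, rfl⟩ := val_surjective a
    obtain ⟨H, rfl⟩ := val_surjective b
    obtain ⟨K, rfl⟩ := val_surjective c
    exact (add_le_add_right_iff G H K).2 h

theorem val_sub (G H : ShortGame) : val (G - H) = val G - val H := by
  rw [sub_eq_add_neg, ← val_neg, ← val_add]
  rfl

/-! ### Outcomes and equality of values -/

theorem moverWins_left {G : ShortGame} :
    G.MoverWins Player.left ↔ ∃ X, IsL X G ∧ ¬ X.MoverWins Player.right := by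
  obtain ⟨m, n, L, R⟩ := G
  constructor
  · rintro ⟨i, h⟩
    exact ⟨L i, ⟨i, rfl⟩, h⟩
  · rintro ⟨_, ⟨i, rfl⟩, h⟩
    exact ⟨i, h⟩

theorem moverWins_right {G : ShortGame} :
    G.MoverWins Player.right ↔ ∃ X, IsR X G ∧ ¬ X.MoverWins Player.left := by
  obtain ⟨m, n, L, R⟩ := G
  constructor
  · rintro ⟨i, h⟩
    exact ⟨R i, ⟨i, rfl⟩, h⟩
  · rintro ⟨_, ⟨i, rfl⟩, h⟩
    exact ⟨i, h⟩

/-- Zero has no options, so of the two ways in which G ≤ 0 or 0 ≤ G can fail only a winning move in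
G remains. -/
theorem moverWins_iff_not_le (G : ShortGame) :
    (G.MoverWins Player.left ↔ ¬ G ≤ 0) ∧ (G.MoverWins Player.right ↔ ¬ 0 ≤ G) := by
  induction G using option_induction with
  | h G ihL ihR =>
    rw [moverWins_left, moverWins_right, not_le_iff, not_le_iff]
    constructor
    · constructor
      · rintro ⟨X, hX, h⟩
        exact Or.inl ⟨X, hX, not_not.1 ((ihL X hX).2.not.1 h)⟩
      · rintro (⟨X, hX, h⟩ | ⟨X, hX, h⟩)
        · exact ⟨X, hX, (ihL X hX).2.not.2 (not_not.2 h)⟩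
        · exact (not_isR_zero hX).elim
    · constructor
      · rintro ⟨X, hX, h⟩
        exact Or.inr ⟨X, hX, not_not.1 ((ihR X hX).1.not.1 h)⟩
      · rintro (⟨X, hX, h⟩ | ⟨X, hX, h⟩)
        · exact (not_isL_zero hX).elim
        · exact ⟨X, hX, (ihR X hX).1.not.2 (not_not.2 h)⟩

theorem outcome_eq_iff {G H : ShortGame} :
    outcome G = outcome H ↔ (val G ≤ 0 ↔ val H ≤ 0) ∧ (0 ≤ val G ↔ 0 ≤ val H) := by
  rw [← val_zero, val_le, val_le, val_le, val_le]
  unfold outcome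
  rw [(moverWins_iff_not_le G).1, (moverWins_iff_not_le G).2, (moverWins_iff_not_le H).1,
    (moverWins_iff_not_le H).2]
  by_cases h1 : G ≤ 0 <;> by_cases h2 : 0 ≤ G <;> by_cases h3 : H ≤ 0 <;>
    by_cases h4 : 0 ≤ H <;> simp [h1, h2, h3, h4]

theorem valueEq_iff {G H : ShortGame} : ValueEq G H ↔ val G = val H := by
  constructor
  · intro h
    -- The context -H suffices to separate values: it turns H into zero.
    have := outcome_eq_iff.1 (h (-H))
    simp only [val_add, val_neg, add_neg_cancel, le_refl, iff_true] at this
    exact le_antisymm (by simpa using this.1) (by simpa using this.2)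
  · intro h X
    rw [outcome_eq_iff, val_add, val_add, h]
    exact ⟨Iff.rfl, Iff.rfl⟩

/-! ### Dyadic rationals as games -/

theorem val_le_val_iff {G H : ShortGame} :
    val G ≤ val H ↔ (∀ X, IsL X G → ¬ val H ≤ val X) ∧ ∀ Y, IsR Y H → ¬ val Y ≤ val G := le_iff

theorem not_val_le_of_isL {X G : ShortGame} (h : IsL X G) : ¬ val G ≤ val X := not_le_of_isL h

theorem not_val_le_of_isR {X G : ShortGame} (h : IsR X G) : ¬ val X ≤ val G := not_le_of_isR h

theorem dyadicForm_zero_left (k : ℕ) : dyadicForm 0 k = 0 := by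
  induction k with
  | zero => rfl
  | succ k ih => simpa [dyadicForm] using ih

theorem dyadicForm_odd (a : ℤ) (k : ℕ) :
    dyadicForm (2 * a + 1) (k + 1) = ofPair (dyadicForm a k) (dyadicForm (a + 1) k) := by
  rw [dyadicForm, if_neg (by simp [parity_simps])]
  congr 2 <;> omega

theorem dyadicForm_even (a : ℤ) (k : ℕ) :
    dyadicForm (2 * a) (k + 1) = dyadicForm a k := by
  rw [dyadicForm, if_pos (by simp)]
  congr 1
  omega

theorem dyadicForm_one_succ (k : ℕ) :
    dyadicForm 1 (k + 1) = ofPair 0 (dyadicForm 1 k) := by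
  have := dyadicForm_odd 0 k
  simpa [dyadicForm_zero_left] using this

/-- The value of the game `1 / 2 ^ k`. -/
def halfPow (k : ℕ) : Val := val (dyadicForm 1 k)

theorem isL_natForm {X : ShortGame} {n : ℕ} : IsL X (natForm n) → ∃ m, n = m + 1 ∧ X = natForm m := by
  cases n with
  | zero => exact fun h => (not_isL_zero h).elim
  | succ n => exact fun ⟨_, h⟩ => ⟨n, rfl, h.symm⟩

theorem not_isR_natForm {X : ShortGame} {n : ℕ} : ¬ IsR X (natForm n) := by
  cases n with
  | zero => exact not_isR_zero
  | succ n => exact fun ⟨i, _⟩ => i.elim0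

theorem halfPow_pos (k : ℕ) : 0 < halfPow k := by
  rw [lt_iff_le_not_ge, ← val_zero]
  induction k with
  | zero =>
    exact ⟨val_le_val_iff.2 ⟨fun X hX => (not_isL_zero hX).elim,
      fun Y hY => (not_isR_natForm (n := 1) hY).elim⟩, not_val_le_of_isL (G := natForm 1) ⟨0, rfl⟩⟩
  | succ k ih =>
    rw [halfPow, dyadicForm_one_succ]
    refine ⟨val_le_val_iff.2 ⟨fun X hX => (not_isL_zero hX).elim, fun Y hY => ?_⟩,
      not_val_le_of_isL (isL_ofPair.2 rfl)⟩
    rw [isR_ofPair.1 hY]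
    exact ih.2

/-- The game 1/2^(k+1) is {0 | 1/2^k}. After one move in its double, what remains is 1/2^(k+1) or
1/2^k + 1/2^(k+1), on the right side of 1/2^k. The hypotheses dispose of the moves in 1/2^k itself;
`halfPow_options` supplies them by induction. -/
theorem halfPow_add_halfPow_of {k : ℕ} (h1 : ∀ X, IsL X (dyadicForm 1 k) → val X ≤ 0)
    (h2 : ∀ X, IsR X (dyadicForm 1 k) → halfPow k + halfPow k ≤ val X) :
    halfPow (k + 1) + halfPow (k + 1) = halfPow k := by
  have hp := halfPow_pos k
  have hq := halfPow_pos (k + 1)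
  have hlt : halfPow (k + 1) ≤ halfPow k := by
    unfold halfPow
    rw [dyadicForm_one_succ]
    refine val_le_val_iff.2 ⟨fun X hX => ?_, fun Y hY hle => ?_⟩
    · rw [isL_ofPair.1 hX]
      exact hp.not_ge
    · refine not_val_le_of_isR (isR_ofPair.2 rfl) (le_trans ?_ hle)
      exact le_trans (le_add_of_nonneg_left hp.le) (h2 Y hY)
  have hne : ¬ halfPow k ≤ halfPow (k + 1) := by
    unfold halfPow
    rw [dyadicForm_one_succ]
    exact not_val_le_of_isR (isR_ofPair.2 rfl)
  have hlt : halfPow (k + 1) < halfPow k := lt_iff_le_not_ge.2 ⟨hlt, hne⟩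
  have hH : halfPow (k + 1) = val (ofPair 0 (dyadicForm 1 k)) := by
    rw [halfPow, dyadicForm_one_succ]
  apply le_antisymm
  · rw [hH, ← val_add, halfPow]
    refine val_le_val_iff.2 ⟨fun X hX => ?_, fun Y hY hle => ?_⟩
    · rcases isL_add.1 hX with ⟨Y, hY, rfl⟩ | ⟨Y, hY, rfl⟩ <;> rw [isL_ofPair.1 hY, val_add, ← hH]
      · rw [val_zero, zero_add]
        exact hne
      · rw [val_zero, add_zero]
        exact hne
    · have := (h2 Y hY).trans hle
      rw [val_add, ← hH] at this
      exact (add_lt_add hlt hlt).not_ge this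
  · rw [hH, ← val_add, halfPow]
    refine val_le_val_iff.2 ⟨fun X hX hle => ?_, fun Y hY => ?_⟩
    · rw [val_add, ← hH] at hle
      exact (add_pos hq hq).not_ge (hle.trans (h1 X hX))
    · rcases isR_add.1 hY with ⟨W, hW, rfl⟩ | ⟨W, hW, rfl⟩ <;> rw [isR_ofPair.1 hW, val_add, ← hH]
      · exact (lt_add_of_pos_right _ hq).not_ge
      · exact (lt_add_of_pos_left _ hq).not_ge

theorem halfPow_options (k : ℕ) : (∀ X, IsL X (dyadicForm 1 k) → val X ≤ 0) ∧
    ∀ X, IsR X (dyadicForm 1 k) → halfPow k + halfPow k ≤ val X := by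
  induction k with
  | zero =>
    refine ⟨fun X hX => ?_, fun Y hY => (not_isR_natForm (n := 1) hY).elim⟩
    obtain ⟨m, hm, rfl⟩ := isL_natForm (n := 1) hX
    obtain rfl : m = 0 := by omega
    exact le_refl _
  | succ k ih =>
    rw [halfPow_add_halfPow_of ih.1 ih.2, dyadicForm_one_succ]
    refine ⟨fun X hX => ?_, fun Y hY => ?_⟩
    · rw [isL_ofPair.1 hX, val_zero]
    · rw [isR_ofPair.1 hY, halfPow]

theorem halfPow_add_halfPow (k : ℕ) : halfPow (k + 1) + halfPow (k + 1) = halfPow k :=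
  halfPow_add_halfPow_of (halfPow_options k).1 (halfPow_options k).2

theorem zsmul_halfPow_le_iff {a b : ℤ} (k : ℕ) : a • halfPow k ≤ b • halfPow k ↔ a ≤ b :=
  (zsmul_left_strictMono (halfPow_pos k)).le_iff_le

theorem zsmul_halfPow_succ (a : ℤ) (k : ℕ) : (2 * a) • halfPow (k + 1) = a • halfPow k := by
  rw [← halfPow_add_halfPow k, mul_comm, mul_smul, two_smul]

theorem val_natForm (n : ℕ) : val (natForm n) = (n : ℤ) • halfPow 0 := by
  suffices h : val (natForm n) = (n : ℤ) • halfPow 0 ∧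
      val (natForm (n + 1)) = val (natForm n) + halfPow 0 from h.1
  have hp := halfPow_pos 0
  have h1 : halfPow 0 = val (natForm 1) := rfl
  induction n with
  | zero =>
    refine ⟨?_, ?_⟩
    · rw [Nat.cast_zero, zero_smul]
      rfl
    · exact (zero_add _).symm
  | succ n ih =>
    refine ⟨by rw [ih.2, ih.1]; push_cast; rw [add_smul, one_smul], ?_⟩
    apply le_antisymm
    · rw [h1, ← val_add]
      refine val_le_val_iff.2 ⟨fun X hX => ?_, fun Y hY => ?_⟩
      · obtain ⟨m, hm, rfl⟩ := isL_natForm hX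
        obtain rfl : n + 1 = m := by omega
        rw [val_add, ← h1]
        exact (lt_add_of_pos_right _ hp).not_ge
      · rcases isR_add.1 hY with ⟨W, hW, rfl⟩ | ⟨W, hW, rfl⟩ <;> exact (not_isR_natForm hW).elim
    · rw [h1, ← val_add]
      refine val_le_val_iff.2 ⟨fun X hX => ?_, fun Y hY => (not_isR_natForm hY).elim⟩
      have hn : ¬ val (natForm (n + 1 + 1)) ≤ val (natForm (n + 1)) := not_val_le_of_isL ⟨0, rfl⟩
      rcases isL_add.1 hX with ⟨Y, hY, rfl⟩ | ⟨Y, hY, rfl⟩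
      · obtain ⟨m, hm, rfl⟩ := isL_natForm hY
        obtain rfl : n = m := by omega
        rwa [val_add, ← h1, ← ih.2]
      · obtain ⟨m, hm, rfl⟩ := isL_natForm hY
        obtain rfl : m = 0 := by omega
        rw [val_add]
        convert hn using 2
        exact add_zero _

/-- The values and the options of the games `m / 2 ^ k`. -/
theorem dyadicForm_spec (k : ℕ) (m : ℤ) : val (dyadicForm m k) = m • halfPow k ∧
    (∀ X, IsL X (dyadicForm m k) → val X ≤ (m - 1) • halfPow k ∧ ∃ a j, X = dyadicForm a j) ∧
    ∀ X, IsR X (dyadicForm m k) → (m + 1) • halfPow k ≤ val X ∧ ∃ a j, X = dyadicForm a j := by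
  induction k generalizing m with
  | zero =>
    cases m with
    | ofNat n =>
      refine ⟨val_natForm n, fun X hX => ?_, fun Y hY => (not_isR_natForm hY).elim⟩
      obtain ⟨m, rfl, rfl⟩ := isL_natForm hX
      refine ⟨?_, (m : ℤ), 0, rfl⟩
      rw [val_natForm, zsmul_halfPow_le_iff]
      simp
    | negSucc n =>
      refine ⟨?_, fun X hX => ?_, fun Y hY => ?_⟩
      · change val (-natForm (n + 1)) = _
        rw [val_neg, val_natForm, ← neg_smul]
        rfl
      · obtain ⟨Y, hY, rfl⟩ := isL_neg.1 hX
        exact (not_isR_natForm hY).elim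
      · obtain ⟨W, hW, rfl⟩ := isR_neg.1 hY
        obtain ⟨m, hm, rfl⟩ := isL_natForm hW
        obtain rfl : n = m := by omega
        refine ⟨?_, -(n : ℤ), 0, ?_⟩
        · rw [val_neg, val_natForm, ← neg_smul, zsmul_halfPow_le_iff]
          omega
        -- Zero and its negative agree only after identifying functions on the empty type.
        · cases n with
          | zero =>
            change mk 0 0 _ _ = mk 0 0 _ _
            congr <;> exact funext fun i => i.elim0
          | succ n => rfl
  | succ k ih =>
    obtain ⟨a, rfl | rfl⟩ := Int.even_or_odd' m
    · rw [dyadicForm_even, zsmul_halfPow_succ]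
      refine ⟨(ih a).1, fun X hX => ⟨((ih a).2.1 X hX).1.trans ?_, ((ih a).2.1 X hX).2⟩,
        fun X hX => ⟨le_trans ?_ ((ih a).2.2 X hX).1, ((ih a).2.2 X hX).2⟩⟩
      · rw [← zsmul_halfPow_succ _ k, zsmul_halfPow_le_iff]
        omega
      · rw [← zsmul_halfPow_succ _ k, zsmul_halfPow_le_iff]
        omega
    · rw [dyadicForm_odd]
      have hZL := not_val_le_of_isL (isL_ofPair (B := dyadicForm (a + 1) k).2 (rfl : dyadicForm a k = _))
      have hZR := not_val_le_of_isR (isR_ofPair (A := dyadicForm a k).2 (rfl : dyadicForm (a + 1) k = _))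
      have hp := halfPow_pos (k + 1)
      have hs := halfPow_add_halfPow k
      have hA := ih a
      have hB := ih (a + 1)
      refine ⟨?_, fun X hX => ?_, fun X hX => ?_⟩
      -- The expected value is written as a/2^k + {0 | 1/2^k}, a sum whose options are known, and
      -- compared with {a/2^k | (a+1)/2^k}.
      · have e : (2 * a + 1) • halfPow (k + 1) = val (dyadicForm a k) + halfPow (k + 1) := by
          rw [add_smul, one_smul, zsmul_halfPow_succ, hA.1]
        have e1 : halfPow (k + 1) = val (ofPair 0 (dyadicForm 1 k)) := by
          rw [halfPow, dyadicForm_one_succ]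
        have e2 : val (dyadicForm (a + 1) k) = val (dyadicForm a k) + halfPow k := by
          rw [hB.1, hA.1, add_smul, one_smul]
        have e3 : (a - 1) • halfPow k + halfPow k = val (dyadicForm a k) := by
          rw [hA.1, sub_smul, one_smul, sub_add_cancel]
        rw [e]
        apply le_antisymm
        · rw [e1, ← val_add]
          refine val_le_val_iff.2 ⟨fun X hX => ?_, fun Y hY hle => ?_⟩
          · rw [isL_ofPair.1 hX, val_add, ← e1]
            exact (lt_add_of_pos_right _ hp).not_ge
          · rcases isR_add.1 hY with ⟨W, hW, rfl⟩ | ⟨W, hW, rfl⟩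
            · rw [val_add, ← e1] at hle
              refine hZR (le_trans ?_ hle)
              rw [hB.1]
              exact (hA.2.2 W hW).1.trans (le_add_of_nonneg_right hp.le)
            · rw [isR_ofPair.1 hW, val_add] at hle
              refine hZR (le_trans ?_ hle)
              rw [e2]
              exact le_refl _
        · rw [e1, ← val_add]
          refine val_le_val_iff.2 ⟨fun X hX hle => ?_, fun Y hY => ?_⟩
          · rcases isL_add.1 hX with ⟨Y, hY, rfl⟩ | ⟨Y, hY, rfl⟩
            · rw [val_add, ← e1] at hle
              refine hZL (hle.trans ?_)
              rw [← e3]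
              refine add_le_add (hA.2.1 Y hY).1 ?_
              rw [← hs]
              exact le_add_of_nonneg_left hp.le
            · rw [isL_ofPair.1 hY, val_add, val_zero, add_zero] at hle
              exact hZL hle
          · rw [isR_ofPair.1 hY, val_add, ← e1, e2, ← hs, ← add_assoc]
            exact (lt_add_of_pos_right _ hp).not_ge
      · rw [isL_ofPair.1 hX]
        refine ⟨?_, a, k, rfl⟩
        rw [hA.1, ← zsmul_halfPow_succ _ k, zsmul_halfPow_le_iff]
        omega
      · rw [isR_ofPair.1 hX]
        refine ⟨?_, a + 1, k, rfl⟩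
        rw [hB.1, ← zsmul_halfPow_succ _ k, zsmul_halfPow_le_iff]
        omega

theorem zsmul_halfPow_add (a : ℤ) (k j : ℕ) :
    (a * 2 ^ j) • halfPow (k + j) = a • halfPow k := by
  induction j with
  | zero => simp
  | succ j ih =>
    rw [← ih, ← zsmul_halfPow_succ _ (k + j), pow_succ, ← add_assoc]
    congr 1
    ring

theorem zsmul_halfPow_eq {a b : ℤ} {k j : ℕ} (h : (a : ℚ) / 2 ^ k = b / 2 ^ j) :
    a • halfPow k = b • halfPow j := by
  rw [div_eq_div_iff (by positivity) (by positivity)] at h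
  have h' : a * 2 ^ j = b * 2 ^ k := by exact_mod_cast h
  rw [← zsmul_halfPow_add a k j, ← zsmul_halfPow_add b j k, h', add_comm]

end ShortGame

/-! ### Arithmetic of dyadic rationals over a common denominator. -/

/-- The dyadic rational `m / 2 ^ k`. -/
def dyadic (m : ℤ) (k : ℕ) : DyadicRat := ⟨(m : ℚ) / 2 ^ k, m, k, rfl⟩

theorem coe_dyadic (m : ℤ) (k : ℕ) : (dyadic m k : ℚ) = (m : ℚ) / 2 ^ k := rfl

theorem exists_eq_dyadic (x : DyadicRat) : ∃ m k, x = dyadic m k := by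
  obtain ⟨_, m, k, rfl⟩ := x
  exact ⟨m, k, rfl⟩

theorem dyadic_add_dyadic (a b : ℤ) (k : ℕ) : dyadic a k + dyadic b k = dyadic (a + b) k :=
  Subtype.ext (by push_cast [coe_dyadic]; ring)

theorem dyadic_mul_two_pow (a : ℤ) (k j : ℕ) : dyadic (a * 2 ^ j) (k + j) = dyadic a k := by
  apply Subtype.ext
  rw [coe_dyadic, coe_dyadic, pow_add]
  push_cast
  field_simp

theorem exists_eq_dyadic₂ (x y : DyadicRat) : ∃ a b k, x = dyadic a k ∧ y = dyadic b k := by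
  obtain ⟨a, k, rfl⟩ := exists_eq_dyadic x
  obtain ⟨b, j, rfl⟩ := exists_eq_dyadic y
  exact ⟨a * 2 ^ j, b * 2 ^ k, k + j, (dyadic_mul_two_pow _ _ _).symm,
    by rw [add_comm, dyadic_mul_two_pow]⟩

theorem dyadic_le_dyadic {a b : ℤ} (k : ℕ) : dyadic a k ≤ dyadic b k ↔ a ≤ b := by
  rw [← Subtype.coe_le_coe, coe_dyadic, coe_dyadic, div_le_div_iff_of_pos_right (by positivity),
    Int.cast_le]

theorem exists_dyadic_between {x y : DyadicRat} (h : x < y) : ∃ z, x < z ∧ z < y := by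
  obtain ⟨a, b, k, rfl, rfl⟩ := exists_eq_dyadic₂ x y
  have h' := h
  rw [← not_le, dyadic_le_dyadic] at h
  refine ⟨dyadic (a + b) (k + 1), ?_, ?_⟩
  · rw [← dyadic_mul_two_pow a k 1, ← not_le, dyadic_le_dyadic]
    omega
  · rw [← dyadic_mul_two_pow b k 1, ← not_le, dyadic_le_dyadic]
    omega

/-! ### Numbers and integers among the values; the simplicity theorem. -/

namespace ShortGame

/-- `num` works from the reduced fraction, in general not the pair (m, k). Its denominator divides
2^k, so the logarithm recovers the exponent, and the value depends only on the rational. -/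
theorem val_num_dyadic (m : ℤ) (k : ℕ) : val (num (dyadic m k)) = m • halfPow k := by
  set x := dyadic m k with hx
  have hden : ∃ j, (x : ℚ).den = 2 ^ j := by
    have h : (x : ℚ).den ∣ 2 ^ k := by
      have h := Rat.den_dvd m (2 ^ k)
      have e : (x : ℚ) = Rat.divInt m (2 ^ k) := by
        rw [Rat.divInt_eq_div]
        push_cast
        rfl
      rw [← e] at h
      exact_mod_cast h
    obtain ⟨j, -, hj⟩ := (Nat.dvd_prime_pow Nat.prime_two).1 h
    exact ⟨j, hj⟩
  obtain ⟨j, hj⟩ := hden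
  rw [num, hj, Nat.log_pow (by norm_num), (dyadicForm_spec _ _).1]
  apply zsmul_halfPow_eq
  have h1 : (x : ℚ) = (x : ℚ).num / (x : ℚ).den := (Rat.num_div_den _).symm
  rw [hj] at h1
  push_cast at h1
  rw [← h1]
  rfl

theorem val_num_dyadic_eq (m : ℤ) (k : ℕ) : val (num (dyadic m k)) = val (dyadicForm m k) := by
  rw [val_num_dyadic, (dyadicForm_spec _ _).1]

theorem val_num_add (x y : DyadicRat) : val (num (x + y)) = val (num x) + val (num y) := by
  obtain ⟨a, b, k, rfl, rfl⟩ := exists_eq_dyadic₂ x y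
  rw [dyadic_add_dyadic, val_num_dyadic, val_num_dyadic, val_num_dyadic, add_smul]

theorem val_num_zero : val (num 0) = 0 := by
  have h : dyadic 0 0 = 0 := Subtype.ext (by simp [coe_dyadic])
  rw [← h, val_num_dyadic, zero_smul]

theorem val_num_neg (x : DyadicRat) : val (num (-x)) = -val (num x) := by
  rw [eq_neg_iff_add_eq_zero, ← val_num_add, neg_add_cancel, val_num_zero]

theorem val_num_sub (x y : DyadicRat) : val (num (x - y)) = val (num x) - val (num y) := by
  rw [sub_eq_add_neg, val_num_add, val_num_neg, sub_eq_add_neg]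

theorem val_num_le {x y : DyadicRat} : val (num x) ≤ val (num y) ↔ x ≤ y := by
  obtain ⟨a, b, k, rfl, rfl⟩ := exists_eq_dyadic₂ x y
  rw [val_num_dyadic, val_num_dyadic, zsmul_halfPow_le_iff, dyadic_le_dyadic]

theorem val_num_inj {x y : DyadicRat} (h : val (num x) = val (num y)) : x = y :=
  le_antisymm (val_num_le.1 h.le) (val_num_le.1 h.ge)

/-- A game is a number if it is equal to a dyadic rational. -/
def IsNumber (G : ShortGame) : Prop := ∃ x : DyadicRat, val G = val (num x)

/-- A game is an integer if it is equal to one. -/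
def IsInteger (G : ShortGame) : Prop := ∃ n : ℤ, val G = val (intForm n)

theorem val_intForm (n : ℤ) : val (intForm n) = val (num (dyadic n 0)) :=
  (val_num_dyadic_eq n 0).symm

theorem IsInteger.isNumber {G : ShortGame} (h : IsInteger G) : IsNumber G := by
  obtain ⟨n, hn⟩ := h
  exact ⟨dyadic n 0, hn.trans (val_intForm n)⟩

/-- The simplicity theorem: a game is a number if some number fits between its Left options and its
Right options. -/
theorem isNumber_of_fits {Z : ShortGame} {x : DyadicRat}
    (hL : ∀ X, IsL X Z → ¬ val (num x) ≤ val X) (hR : ∀ X, IsR X Z → ¬ val X ≤ val (num x)) :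
    IsNumber Z := by
  suffices h : ∀ N : ShortGame, (∃ m k, N = dyadicForm m k) → (∀ X, IsL X Z → ¬ val N ≤ val X) →
      (∀ X, IsR X Z → ¬ val X ≤ val N) → IsNumber Z from h (num x) ⟨_, _, rfl⟩ hL hR
  intro N
  induction N using option_induction with
  | h N ihL ihR =>
    rintro ⟨m, k, rfl⟩ hL hR
    obtain ⟨h0, h1, h2⟩ := dyadicForm_spec k m
    -- If N fits but differs from Z, some option of N witnesses this. That option lies between N and
    -- Z in the order, so it fits as well, and the induction continues with it.
    by_cases hY : ∃ Y, IsR Y (dyadicForm m k) ∧ val Y ≤ val Z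
    · obtain ⟨Y, hY, hYZ⟩ := hY
      refine ihR Y hY (h2 Y hY).2 (fun X hX hle => hL X hX (le_trans ?_ hle))
        (fun X hX hle => not_val_le_of_isR hX (hle.trans hYZ))
      refine le_trans ?_ (h2 Y hY).1
      rw [h0, zsmul_halfPow_le_iff]
      omega
    by_cases hY' : ∃ Y, IsL Y (dyadicForm m k) ∧ val Z ≤ val Y
    · obtain ⟨Y, hY, hYZ⟩ := hY'
      refine ihL Y hY (h1 Y hY).2 (fun X hX hle => not_val_le_of_isL hX (hYZ.trans hle))
        (fun X hX hle => hR X hX (hle.trans ?_))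
      refine (h1 Y hY).1.trans ?_
      rw [h0, zsmul_halfPow_le_iff]
      omega
    push Not at hY hY'
    refine ⟨dyadic m k, ?_⟩
    rw [val_num_dyadic_eq]
    exact le_antisymm (val_le_val_iff.2 ⟨hL, hY⟩) (val_le_val_iff.2 ⟨hY', hR⟩)

theorem exists_le_natForm (G : ShortGame) : ∃ n : ℕ, val G ≤ val (natForm n) := by
  induction G with
  | mk m n L R ihL _ =>
    choose f hf using ihL
    refine ⟨Finset.univ.sup f + 1, val_le_val_iff.2 ⟨?_, fun Y hY => (not_isR_natForm hY).elim⟩⟩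
    rintro _ ⟨i, rfl⟩ hle
    have h1 := hle.trans (hf i)
    rw [val_natForm, val_natForm, zsmul_halfPow_le_iff] at h1
    have h2 := Finset.le_sup (f := f) (Finset.mem_univ i)
    omega

theorem exists_int_floor (G : ShortGame) :
    ∃ n : ℤ, val (intForm n) ≤ val G ∧ ¬ val (intForm (n + 1)) ≤ val G := by
  obtain ⟨a, ha⟩ := exists_le_natForm G
  obtain ⟨b, hb⟩ := exists_le_natForm (-G)
  have hi : ∀ n : ℤ, val (intForm n) = n • halfPow 0 := fun n => (dyadicForm_spec 0 n).1
  have hb' : val (intForm (-b)) ≤ val G := by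
    rw [hi, neg_smul, ← val_natForm]
    exact neg_le.1 hb
  obtain ⟨n, hn, hn'⟩ := Int.exists_greatest_of_bdd (P := fun n => val (intForm n) ≤ val G)
    ⟨a, fun z hz => by
      have := hz.trans ha
      rwa [val_natForm, hi, zsmul_halfPow_le_iff] at this⟩ ⟨_, hb'⟩
  exact ⟨n, hn, fun h => by have := hn' _ h; omega⟩

/-- Let n be the integer floor of G. If no Left option reached n, then G ≤ n would follow and G
would equal n. -/
theorem exists_int_le_isL {G : ShortGame} (hG : ¬ IsInteger G) :
    ∃ n : ℤ, ¬ val (intForm (n + 1)) ≤ val G ∧ ∃ X, IsL X G ∧ val (intForm n) ≤ val X := by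
  obtain ⟨n, hn, hn'⟩ := exists_int_floor G
  refine ⟨n, hn', ?_⟩
  by_contra! h
  refine hG ⟨n, le_antisymm (val_le_val_iff.2 ⟨h, fun Y hY hle => hn' ?_⟩) hn⟩
  have := ((dyadicForm_spec 0 n).2.2 Y hY).1
  rw [← (dyadicForm_spec 0 (n + 1)).1] at this
  exact this.trans hle

theorem IsInteger.neg {G : ShortGame} (h : IsInteger G) : IsInteger (-G) := by
  obtain ⟨n, hn⟩ := h
  refine ⟨-n, ?_⟩
  rw [val_neg, hn]
  exact (by rw [(dyadicForm_spec 0 n).1, ← neg_smul, ← (dyadicForm_spec 0 (-n)).1] :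
    -val (dyadicForm n 0) = val (dyadicForm (-n) 0))

theorem isInteger_neg_iff {G : ShortGame} : IsInteger (-G) ↔ IsInteger G := by
  refine ⟨fun h => ?_, IsInteger.neg⟩
  obtain ⟨n, hn⟩ := h.neg
  refine ⟨n, ?_⟩
  rwa [val_neg, val_neg, neg_neg] at hn

theorem exists_int_ge_isR {G : ShortGame} (hG : ¬ IsInteger G) :
    ∃ n : ℤ, ¬ val G ≤ val (intForm (n - 1)) ∧ ∃ X, IsR X G ∧ val X ≤ val (intForm n) := by
  have hi : ∀ n : ℤ, val (intForm n) = n • halfPow 0 := fun n => (dyadicForm_spec 0 n).1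
  obtain ⟨n, hn, X, hX, hle⟩ := exists_int_le_isL (isInteger_neg_iff.not.2 hG)
  obtain ⟨Y, hY, rfl⟩ := isL_neg.1 hX
  refine ⟨-n, fun h => hn ?_, Y, hY, ?_⟩
  · rw [hi] at h ⊢
    rw [val_neg, le_neg, ← neg_smul]
    convert h using 2
    ring
  · rw [hi] at hle ⊢
    rw [val_neg, le_neg, ← neg_smul] at hle
    exact hle

/-- Together with its mirror image this keeps the default value 0 of `maxOf` and `minOf` out of the
stops of non-numbers and the scaffolds of non-integers. -/
theorem exists_isL_of_not_isInteger {G : ShortGame} (hG : ¬ IsInteger G) : ∃ X, IsL X G :=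
  let ⟨_, _, X, hX, _⟩ := exists_int_le_isL hG
  ⟨X, hX⟩

theorem exists_isR_of_not_isInteger {G : ShortGame} (hG : ¬ IsInteger G) : ∃ X, IsR X G :=
  let ⟨_, _, X, hX, _⟩ := exists_int_ge_isR hG
  ⟨X, hX⟩

/-! ### Stops -/

theorem le_maxOf {m : ℕ} (f : Fin m → ℚ) (i : Fin m) : f i ≤ maxOf f := by
  have h : (Finset.univ : Finset (Fin m)).Nonempty := ⟨i, Finset.mem_univ i⟩
  rw [maxOf, dif_pos h]
  exact Finset.le_sup' f (Finset.mem_univ i)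

theorem minOf_le {m : ℕ} (f : Fin m → ℚ) (i : Fin m) : minOf f ≤ f i := by
  have h : (Finset.univ : Finset (Fin m)).Nonempty := ⟨i, Finset.mem_univ i⟩
  rw [minOf, dif_pos h]
  exact Finset.inf'_le f (Finset.mem_univ i)

theorem exists_maxOf_eq {m : ℕ} (f : Fin m → ℚ) (i : Fin m) : ∃ i, maxOf f = f i := by
  have h : (Finset.univ : Finset (Fin m)).Nonempty := ⟨i, Finset.mem_univ i⟩
  rw [maxOf, dif_pos h]
  obtain ⟨i, -, hi⟩ := Finset.exists_mem_eq_sup' h f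
  exact ⟨i, hi⟩

theorem exists_minOf_eq {m : ℕ} (f : Fin m → ℚ) (i : Fin m) : ∃ i, minOf f = f i := by
  have h : (Finset.univ : Finset (Fin m)).Nonempty := ⟨i, Finset.mem_univ i⟩
  rw [minOf, dif_pos h]
  obtain ⟨i, -, hi⟩ := Finset.exists_mem_eq_inf' h f
  exact ⟨i, hi⟩

theorem stopValue_of_val_eq_num {G : ShortGame} {x : DyadicRat} (h : val G = val (num x))
    (p : Player) : G.stopValue p = x := by
  obtain ⟨m, n, L, R⟩ := G
  have hx : ∃ x : DyadicRat, ValueEq (mk m n L R) (num x) := ⟨x, valueEq_iff.2 h⟩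
  have := valueEq_iff.1 hx.choose_spec
  rw [h] at this
  cases p <;> rw [stopValue, dif_pos hx, ← val_num_inj this]

theorem LS_of_val_eq_num {G : ShortGame} {x : DyadicRat} (h : val G = val (num x)) : LS G = x :=
  stopValue_of_val_eq_num h _

theorem RS_of_val_eq_num {G : ShortGame} {x : DyadicRat} (h : val G = val (num x)) : RS G = x :=
  stopValue_of_val_eq_num h _

theorem isNumber_iff_exists_valueEq {G : ShortGame} :
    IsNumber G ↔ ∃ x : DyadicRat, ValueEq G (num x) := by
  simp only [valueEq_iff, IsNumber]

theorem LS_mk {m n : ℕ} {L : Fin m → ShortGame} {R : Fin n → ShortGame}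
    (h : ¬ IsNumber (mk m n L R)) : LS (mk m n L R) = maxOf fun i => RS (L i) := by
  rw [LS, stopValue, dif_neg (isNumber_iff_exists_valueEq.not.1 h)]
  rfl

theorem RS_mk {m n : ℕ} {L : Fin m → ShortGame} {R : Fin n → ShortGame}
    (h : ¬ IsNumber (mk m n L R)) : RS (mk m n L R) = minOf fun j => LS (R j) := by
  rw [RS, stopValue, dif_neg (isNumber_iff_exists_valueEq.not.1 h)]
  rfl

theorem exists_isL_of_not_isNumber {G : ShortGame} (hG : ¬ IsNumber G) : ∃ X, IsL X G :=
  exists_isL_of_not_isInteger fun h => hG h.isNumber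

theorem exists_isR_of_not_isNumber {G : ShortGame} (hG : ¬ IsNumber G) : ∃ X, IsR X G :=
  exists_isR_of_not_isInteger fun h => hG h.isNumber

theorem RS_le_LS_of_isL {X G : ShortGame} (hG : ¬ IsNumber G) (h : IsL X G) : RS X ≤ LS G := by
  obtain ⟨m, n, L, R⟩ := G
  obtain ⟨i, rfl⟩ := h
  rw [LS_mk hG]
  exact le_maxOf (fun i => RS (L i)) i

theorem RS_le_LS_of_isR {X G : ShortGame} (hG : ¬ IsNumber G) (h : IsR X G) : RS G ≤ LS X := by
  obtain ⟨m, n, L, R⟩ := G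
  obtain ⟨j, rfl⟩ := h
  rw [RS_mk hG]
  exact minOf_le (fun j => LS (R j)) j

theorem exists_LS_eq {G : ShortGame} (hG : ¬ IsNumber G) : ∃ X, IsL X G ∧ LS G = RS X := by
  obtain ⟨X, hX⟩ := exists_isL_of_not_isNumber hG
  obtain ⟨m, n, L, R⟩ := G
  obtain ⟨i, rfl⟩ := hX
  rw [LS_mk hG]
  obtain ⟨i, hi⟩ := exists_maxOf_eq (fun i => RS (L i)) i
  exact ⟨L i, ⟨i, rfl⟩, hi⟩

theorem exists_RS_eq {G : ShortGame} (hG : ¬ IsNumber G) : ∃ X, IsR X G ∧ RS G = LS X := by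
  obtain ⟨X, hX⟩ := exists_isR_of_not_isNumber hG
  obtain ⟨m, n, L, R⟩ := G
  obtain ⟨i, rfl⟩ := hX
  rw [RS_mk hG]
  obtain ⟨i, hi⟩ := exists_minOf_eq (fun i => LS (R i)) i
  exact ⟨R i, ⟨i, rfl⟩, hi⟩

theorem exists_stops_eq_coe (G : ShortGame) :
    (∃ x : DyadicRat, LS G = x) ∧ ∃ x : DyadicRat, RS G = x := by
  induction G using option_induction with
  | h G ihL ihR =>
    by_cases hG : IsNumber G
    · obtain ⟨x, hx⟩ := hG
      exact ⟨⟨x, LS_of_val_eq_num hx⟩, ⟨x, RS_of_val_eq_num hx⟩⟩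
    · obtain ⟨X, hX, hX'⟩ := exists_LS_eq hG
      obtain ⟨Y, hY, hY'⟩ := exists_RS_eq hG
      rw [hX', hY']
      exact ⟨(ihL X hX).2, (ihR Y hY).1⟩

/-- Number avoidance. If x ≤ G failed because of a Left option y of x with G ≤ y, then y would fit
between the options of G, and G would be a number. -/
theorem num_le_iff_of_not_isNumber {G : ShortGame} (hG : ¬ IsNumber G) (x : DyadicRat) :
    val (num x) ≤ val G ↔ ∀ Y, IsR Y G → ¬ val Y ≤ val (num x) := by
  refine ⟨fun h => (val_le_val_iff.1 h).2, fun h => ?_⟩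
  by_contra hle
  have hL : ∀ X, IsL X (num x) → val X ≤ val (num x) ∧ ∃ y, val X = val (num y) := by
    intro X hX
    obtain ⟨h0, h1, -⟩ := dyadicForm_spec (Nat.log 2 (x : ℚ).den) (x : ℚ).num
    obtain ⟨h1, a, k, rfl⟩ := h1 X hX
    refine ⟨h1.trans ?_, dyadic a k, (val_num_dyadic_eq _ _).symm⟩
    rw [num, h0, zsmul_halfPow_le_iff]
    omega
  rcases not_le_iff.1 hle with ⟨X, hX, h'⟩ | ⟨Y, hY, h'⟩
  · obtain ⟨h1, y, hy⟩ := hL X hX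
    change val G ≤ val X at h'
    refine hG (isNumber_of_fits (x := y) (fun Z hZ hle => ?_) fun Z hZ hle => ?_)
    · rw [← hy] at hle
      exact not_val_le_of_isL hZ (h'.trans hle)
    · rw [← hy] at hle
      exact h Z hZ (hle.trans h1)
  · exact h Y hY h'

theorem le_num_iff_of_not_isNumber {G : ShortGame} (hG : ¬ IsNumber G) (x : DyadicRat) :
    val G ≤ val (num x) ↔ ∀ Y, IsL Y G → ¬ val (num x) ≤ val Y := by
  refine ⟨fun h => (val_le_val_iff.1 h).1, fun h => ?_⟩
  by_contra hle
  have hL : ∀ X, IsR X (num x) → val (num x) ≤ val X ∧ ∃ y, val X = val (num y) := by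
    intro X hX
    obtain ⟨h0, -, h1⟩ := dyadicForm_spec (Nat.log 2 (x : ℚ).den) (x : ℚ).num
    obtain ⟨h1, a, k, rfl⟩ := h1 X hX
    refine ⟨le_trans ?_ h1, dyadic a k, (val_num_dyadic_eq _ _).symm⟩
    rw [num, h0, zsmul_halfPow_le_iff]
    omega
  rcases not_le_iff.1 hle with ⟨Y, hY, h'⟩ | ⟨X, hX, h'⟩
  · exact h Y hY h'
  · obtain ⟨h1, y, hy⟩ := hL X hX
    change val X ≤ val G at h'
    refine hG (isNumber_of_fits (x := y) (fun Z hZ hle => ?_) fun Z hZ hle => ?_)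
    · rw [← hy] at hle
      exact h Z hZ (h1.trans hle)
    · rw [← hy] at hle
      exact not_val_le_of_isR hZ (hle.trans h')

/-- Comparison of a game with a number by means of the stops. -/
theorem stops_spec (G : ShortGame) (x : DyadicRat) :
    ((x : ℚ) < RS G → val (num x) ≤ val G) ∧ (LS G < x → val G ≤ val (num x)) ∧
      (val (num x) ≤ val G → (x : ℚ) ≤ RS G) ∧ (val G ≤ val (num x) → LS G ≤ x) := by
  induction G using option_induction with
  | h G ihL ihR =>
    by_cases hG : IsNumber G
    · obtain ⟨y, hy⟩ := hG
      rw [LS_of_val_eq_num hy, RS_of_val_eq_num hy, hy, val_num_le, val_num_le]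
      exact ⟨fun h => le_of_lt h, fun h => le_of_lt h, fun h => h, fun h => h⟩
    · rw [num_le_iff_of_not_isNumber hG, le_num_iff_of_not_isNumber hG]
      refine ⟨fun h Y hY hle => ?_, fun h Y hY hle => ?_, fun h => ?_, fun h => ?_⟩
      · exact (((ihR Y hY).2.2.2 hle).trans_lt h).not_ge (RS_le_LS_of_isR hG hY)
      · exact (h.trans_le ((ihL Y hY).2.2.1 hle)).not_ge (RS_le_LS_of_isL hG hY)
      · obtain ⟨Y, hY, hY'⟩ := exists_RS_eq hG
        rw [hY']
        by_contra! hlt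
        exact h Y hY ((ihR Y hY).2.1 hlt)
      · obtain ⟨Y, hY, hY'⟩ := exists_LS_eq hG
        rw [hY']
        by_contra! hlt
        exact h Y hY ((ihL Y hY).1 hlt)

theorem num_le_of_lt_RS {G : ShortGame} {x : DyadicRat} : (x : ℚ) < RS G → val (num x) ≤ val G :=
  (stops_spec G x).1

theorem le_num_of_LS_lt {G : ShortGame} {x : DyadicRat} : LS G < x → val G ≤ val (num x) :=
  (stops_spec G x).2.1

theorem le_RS_of_num_le {G : ShortGame} {x : DyadicRat} : val (num x) ≤ val G → (x : ℚ) ≤ RS G :=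
  (stops_spec G x).2.2.1

theorem LS_le_of_le_num {G : ShortGame} {x : DyadicRat} : val G ≤ val (num x) → LS G ≤ x :=
  (stops_spec G x).2.2.2

theorem RS_le_LS (G : ShortGame) : RS G ≤ LS G := by
  obtain ⟨⟨x, hx⟩, y, hy⟩ := exists_stops_eq_coe G
  by_contra! hlt
  rw [hx, hy] at hlt
  -- Two dyadics z < w in the supposed gap give w ≤ G ≤ z; a single one would give no contradiction.
  obtain ⟨z, hxz, hzy⟩ := exists_dyadic_between (Subtype.coe_lt_coe.1 hlt)
  obtain ⟨w, hzw, hwy⟩ := exists_dyadic_between hzy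
  have h1 : val G ≤ val (num z) := le_num_of_LS_lt (by rw [hx]; exact hxz)
  have h2 : val (num w) ≤ val G := num_le_of_lt_RS (by rw [hy]; exact hwy)
  exact (val_num_le.1 (h2.trans h1)).not_gt hzw

theorem RS_add_le_of_val_eq {G H : ShortGame} {y : DyadicRat}
    (h : val H = val G + val (num y)) : RS G + y ≤ RS H := by
  obtain ⟨-, u, hu⟩ := exists_stops_eq_coe G
  obtain ⟨-, v, hv⟩ := exists_stops_eq_coe H
  by_contra! hlt
  rw [hu, hv] at hlt
  have hlt : v < u + y := hlt
  obtain ⟨w, h1, h2⟩ := exists_dyadic_between hlt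
  have h3 : val (num (w - y)) ≤ val G :=
    num_le_of_lt_RS (by rw [hu]; exact (sub_lt_iff_lt_add.2 h2 : w - y < u))
  have h4 : val (num w) ≤ val H := by
    rw [h, ← sub_le_iff_le_add, ← val_num_sub]
    exact h3
  have h5 := le_RS_of_num_le h4
  rw [hv] at h5
  exact (show w ≤ v from h5).not_gt h1

theorem LS_le_add_of_val_eq {G H : ShortGame} {y : DyadicRat}
    (h : val H = val G + val (num y)) : LS H ≤ LS G + y := by
  obtain ⟨⟨u, hu⟩, -⟩ := exists_stops_eq_coe G
  obtain ⟨⟨v, hv⟩, -⟩ := exists_stops_eq_coe H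
  by_contra! hlt
  rw [hu, hv] at hlt
  have hlt : u + y < v := hlt
  obtain ⟨w, h1, h2⟩ := exists_dyadic_between hlt
  have h3 : val G ≤ val (num (w - y)) :=
    le_num_of_LS_lt (by rw [hu]; exact (lt_sub_iff_add_lt.2 h1 : u < w - y))
  have h4 : val H ≤ val (num w) := by
    rw [h, ← le_sub_iff_add_le, ← val_num_sub]
    exact h3
  have h5 := LS_le_of_le_num h4
  rw [hv] at h5
  exact (show v ≤ w from h5).not_gt h2

/-- Comparisons with dyadics determine the stops, and they shift with y. Each inequality is reversed
by applying it to the shift by -y. -/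
theorem stops_of_val_eq_add {G H : ShortGame} {y : DyadicRat}
    (h : val H = val G + val (num y)) : LS H = LS G + y ∧ RS H = RS G + y := by
  have h' : val G = val H + val (num (-y)) := by rw [h, val_num_neg, add_neg_cancel_right]
  have h1 := RS_add_le_of_val_eq h
  have h2 := LS_le_add_of_val_eq h
  have h3 := RS_add_le_of_val_eq h'
  have h4 := LS_le_add_of_val_eq h'
  push_cast at h3 h4
  constructor <;> linarith

theorem LS_add_num (G : ShortGame) (y : DyadicRat) : LS (G + num y) = LS G + y :=
  (stops_of_val_eq_add (val_add _ _)).1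

theorem stops_sub_num (G : ShortGame) (y : DyadicRat) :
    LS (G - num y) = LS G - y ∧ RS (G - num y) = RS G - y := by
  have h : val (G - num y) = val G + val (num (-y)) := by
    rw [val_sub, val_num_neg, sub_eq_add_neg]
  have := stops_of_val_eq_add h
  push_cast at this
  simpa only [sub_eq_add_neg] using this

theorem infClose_num_iff {G : ShortGame} {x : DyadicRat} :
    InfClose G (num x) ↔ LS G = x ∧ RS G = x := by
  rw [InfClose, (stops_sub_num G x).1, (stops_sub_num G x).2, sub_eq_zero, sub_eq_zero]

theorem exists_infClose_num_iff {G : ShortGame} :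
    (∃ x : DyadicRat, InfClose G (num x)) ↔ LS G = RS G := by
  constructor
  · rintro ⟨x, hx⟩
    obtain ⟨h1, h2⟩ := infClose_num_iff.1 hx
    rw [h1, h2]
  · intro h
    obtain ⟨⟨x, hx⟩, -⟩ := exists_stops_eq_coe G
    exact ⟨x, infClose_num_iff.2 ⟨hx, h ▸ hx⟩⟩

/-- The stops of a game with options on both sides, from the stops of its options. -/
theorem stops_mk {m n : ℕ} (L : Fin m → ShortGame) (R : Fin n → ShortGame) (i₀ : Fin m)
    (j₀ : Fin n) {l r : ℚ} (hl : l = maxOf fun i => RS (L i)) (hr : r = minOf fun j => LS (R j)) :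
    (r < l → LS (mk m n L R) = l ∧ RS (mk m n L R) = r) ∧
      (l ≤ r → LS (mk m n L R) = RS (mk m n L R) ∧ l ≤ LS (mk m n L R) ∧ LS (mk m n L R) ≤ r) := by
  -- A number lies between the relevant stops of its options, which excludes r < l. It need not
  -- equal l or r, hence only bounds when l ≤ r.
  by_cases hG : IsNumber (mk m n L R)
  · obtain ⟨x, hx⟩ := hG
    have h1 : l ≤ x := by
      obtain ⟨i, hi⟩ := exists_maxOf_eq (fun i => RS (L i)) i₀
      rw [hl, hi]
      by_contra! hlt
      refine not_val_le_of_isL (isL_apply L R i) ?_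
      rw [hx]
      exact num_le_of_lt_RS hlt
    have h2 : (x : ℚ) ≤ r := by
      obtain ⟨j, hj⟩ := exists_minOf_eq (fun j => LS (R j)) j₀
      rw [hr, hj]
      by_contra! hlt
      refine not_val_le_of_isR (isR_apply L R j) ?_
      rw [hx]
      exact le_num_of_LS_lt hlt
    rw [LS_of_val_eq_num hx, RS_of_val_eq_num hx]
    exact ⟨fun h => absurd (h1.trans h2) h.not_ge, fun _ => ⟨rfl, h1, h2⟩⟩
  · have h := RS_le_LS (mk m n L R)
    rw [LS_mk hG, RS_mk hG, ← hl, ← hr] at h ⊢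
    exact ⟨fun _ => ⟨rfl, rfl⟩, fun h' => ⟨le_antisymm h' h, le_refl _, h'⟩⟩

end ShortGame

/-! ### Piecewise affine functions on the dyadic rationals -/

/-- On each of the intervals `[j / 2 ^ k, (j + 1) / 2 ^ k]` with `j / 2 ^ k ≥ -1`, the function `f` is
affine of slope `c` or `c + 1`, and its values at the points `j / 2 ^ k` are multiples of `1 / 2 ^ k`. -/
structure GridAffine (k : ℕ) (c : ℤ) (f : DyadicRat → ℚ) : Prop where
  value : ∀ j : ℤ, -2 ^ k ≤ j → ∃ n : ℤ, f (dyadic j k) = n * (2 ^ k)⁻¹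
  cell : ∀ j : ℤ, -2 ^ k ≤ j → ∃ d : ℤ, (d = c ∨ d = c + 1) ∧ ∀ t : DyadicRat,
    dyadic j k ≤ t → t ≤ dyadic (j + 1) k →
      f t = f (dyadic j k) + d * ((t : ℚ) - j * (2 ^ k)⁻¹)

theorem coe_dyadic_eq_mul (j : ℤ) (k : ℕ) : (dyadic j k : ℚ) = j * (2 ^ k)⁻¹ := by
  rw [coe_dyadic, div_eq_mul_inv]

theorem dyadic_le_iff {j : ℤ} {k : ℕ} {t : DyadicRat} :
    dyadic j k ≤ t ↔ (j : ℚ) * (2 ^ k)⁻¹ ≤ t := by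
  rw [← coe_dyadic_eq_mul]
  rfl

theorem le_dyadic_iff {j : ℤ} {k : ℕ} {t : DyadicRat} :
    t ≤ dyadic j k ↔ (t : ℚ) ≤ j * (2 ^ k)⁻¹ := by
  rw [← coe_dyadic_eq_mul]
  rfl

theorem lt_dyadic_iff {j : ℤ} {k : ℕ} {t : DyadicRat} :
    t < dyadic j k ↔ (t : ℚ) < j * (2 ^ k)⁻¹ := by
  rw [← coe_dyadic_eq_mul]
  rfl

theorem dyadic_double (a : ℤ) (k : ℕ) : dyadic (2 * a) (k + 1) = dyadic a k := by
  rw [← dyadic_mul_two_pow a k 1]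
  congr 1
  ring

theorem dyadic_neg_two_pow (k : ℕ) : dyadic (-2 ^ k) k = -1 := by
  apply Subtype.ext
  rw [coe_dyadic]
  push_cast
  rw [neg_div, div_self (by positivity)]

theorem neg_one_le_dyadic {j : ℤ} {k : ℕ} : -1 ≤ dyadic j k ↔ -2 ^ k ≤ j := by
  rw [← dyadic_neg_two_pow k, dyadic_le_dyadic]

theorem inv_two_pow_succ (k : ℕ) : ((2 : ℚ) ^ k)⁻¹ = 2 * (2 ^ (k + 1))⁻¹ := by
  rw [pow_succ]
  field_simp

theorem exists_cell (k : ℕ) {t : DyadicRat} (ht : -1 ≤ t) :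
    ∃ j : ℤ, -2 ^ k ≤ j ∧ dyadic j k ≤ t ∧ t < dyadic (j + 1) k := by
  have hk : (0 : ℚ) < 2 ^ k := by positivity
  have ht' : (-1 : ℚ) ≤ t := ht
  refine ⟨⌊(t : ℚ) * 2 ^ k⌋, ?_, ?_, ?_⟩
  · rw [Int.le_floor]
    push_cast
    nlinarith
  · rw [dyadic_le_iff, ← div_eq_mul_inv, div_le_iff₀ hk]
    exact Int.floor_le _
  · rw [lt_dyadic_iff, ← div_eq_mul_inv, lt_div_iff₀ hk]
    push_cast
    exact Int.lt_floor_add_one _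

namespace GridAffine

variable {k : ℕ} {c : ℤ} {f g : DyadicRat → ℚ}

theorem congr (hf : GridAffine k c f) (h : ∀ t, -1 ≤ t → f t = g t) : GridAffine k c g := by
  refine ⟨fun j hj => ?_, fun j hj => ?_⟩
  · rw [← h _ (neg_one_le_dyadic.2 hj)]
    exact hf.value j hj
  · obtain ⟨d, hd, hd'⟩ := hf.cell j hj
    refine ⟨d, hd, fun t ht ht' => ?_⟩
    rw [← h _ (neg_one_le_dyadic.2 hj), ← h t ((neg_one_le_dyadic.2 hj).trans ht)]
    exact hd' t ht ht'

theorem const (k : ℕ) {c : ℤ} (hc : 0 = c ∨ 0 = c + 1) (n : ℤ) :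
    GridAffine k c fun _ => (n : ℚ) * (2 ^ k)⁻¹ :=
  ⟨fun _ _ => ⟨n, rfl⟩, fun _ _ => ⟨0, hc, fun _ _ _ => by simp⟩⟩

theorem neg (hf : GridAffine k c f) : GridAffine k (-c - 1) fun t => -f t := by
  refine ⟨fun j hj => ?_, fun j hj => ?_⟩
  · obtain ⟨n, hn⟩ := hf.value j hj
    exact ⟨-n, by rw [hn]; push_cast; ring⟩
  · obtain ⟨d, hd, hd'⟩ := hf.cell j hj
    exact ⟨-d, by omega, fun t ht ht' => by rw [hd' t ht ht']; push_cast; ring⟩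

theorem add_id (hf : GridAffine k c f) : GridAffine k (c + 1) fun t => f t + t := by
  refine ⟨fun j hj => ?_, fun j hj => ?_⟩
  · obtain ⟨n, hn⟩ := hf.value j hj
    exact ⟨n + j, by rw [hn, coe_dyadic_eq_mul]; push_cast; ring⟩
  · obtain ⟨d, hd, hd'⟩ := hf.cell j hj
    exact ⟨d + 1, by omega, fun t ht ht' => by
      rw [hd' t ht ht', coe_dyadic_eq_mul]; push_cast; ring⟩

theorem sub_id (hf : GridAffine k c f) : GridAffine k (c - 1) fun t => f t - t := by
  refine ⟨fun j hj => ?_, fun j hj => ?_⟩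
  · obtain ⟨n, hn⟩ := hf.value j hj
    exact ⟨n - j, by rw [hn, coe_dyadic_eq_mul]; push_cast; ring⟩
  · obtain ⟨d, hd, hd'⟩ := hf.cell j hj
    exact ⟨d - 1, by omega, fun t ht ht' => by
      rw [hd' t ht ht', coe_dyadic_eq_mul]; push_cast; ring⟩

/-- Slopes are integers, so at the midpoint of a cell the value is a multiple of half the old step.
-/
theorem succ (hf : GridAffine k c f) : GridAffine (k + 1) c f := by
  have hu := inv_two_pow_succ k
  have hpos : (0 : ℚ) < (2 ^ (k + 1))⁻¹ := by positivity
  have key : ∀ j : ℤ, -2 ^ (k + 1) ≤ j → ∃ a : ℤ, -2 ^ k ≤ a ∧ (j = 2 * a ∨ j = 2 * a + 1) := by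
    intro j hj
    rw [pow_succ] at hj
    obtain ⟨a, ha⟩ := Int.even_or_odd' j
    exact ⟨a, by omega, ha⟩
  refine ⟨fun j hj => ?_, fun j hj => ?_⟩
  · obtain ⟨a, ha, rfl | rfl⟩ := key j hj
    · obtain ⟨n, hn⟩ := hf.value a ha
      exact ⟨2 * n, by rw [dyadic_double, hn, hu]; push_cast; ring⟩
    · obtain ⟨n, hn⟩ := hf.value a ha
      obtain ⟨d, hd, hd'⟩ := hf.cell a ha
      refine ⟨2 * n + d, ?_⟩
      rw [hd', hn, coe_dyadic_eq_mul, hu]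
      · push_cast
        ring
      · rw [← dyadic_double, dyadic_le_dyadic]
        omega
      · rw [← dyadic_double (a + 1), dyadic_le_dyadic]
        omega
  · obtain ⟨a, ha, rfl | rfl⟩ := key j hj
    · obtain ⟨d, hd, hd'⟩ := hf.cell a ha
      refine ⟨d, hd, fun t ht ht' => ?_⟩
      rw [dyadic_double] at ht ⊢
      rw [hd' t ht, hu]
      · push_cast
        ring
      · refine ht'.trans ?_
        rw [← dyadic_double (a + 1), dyadic_le_dyadic]
        omega
    · obtain ⟨d, hd, hd'⟩ := hf.cell a ha
      refine ⟨d, hd, fun t ht ht' => ?_⟩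
      have h1 : dyadic a k ≤ dyadic (2 * a + 1) (k + 1) := by
        rw [← dyadic_double, dyadic_le_dyadic]
        omega
      have h2 : dyadic (2 * a + 1 + 1) (k + 1) = dyadic (a + 1) k := by
        rw [← dyadic_double (a + 1)]
        congr 1
        ring
      rw [h2] at ht'
      rw [hd' t (h1.trans ht) ht', hd' _ h1 (ht.trans ht'), coe_dyadic_eq_mul, hu]
      push_cast
      ring

theorem mono {k' : ℕ} (hf : GridAffine k c f) (h : k ≤ k') : GridAffine k' c f := by
  induction h with
  | refl => exact hf
  | step _ ih => exact ih.succ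

theorem slope_bounds (hf : GridAffine k c f) {t t' : DyadicRat} (ht : -1 ≤ t) (htt' : t ≤ t') :
    (c : ℚ) * (t' - t) ≤ f t' - f t ∧ f t' - f t ≤ (c + 1) * (t' - t) := by
  have hcell : ∀ j : ℤ, -2 ^ k ≤ j → ∀ u v : DyadicRat, dyadic j k ≤ u → u ≤ v →
      v ≤ dyadic (j + 1) k → (c : ℚ) * (v - u) ≤ f v - f u ∧ f v - f u ≤ (c + 1) * (v - u) := by
    intro j hj u v hu huv hv
    obtain ⟨d, hd, hd'⟩ := hf.cell j hj
    rw [hd' v (hu.trans huv) hv, hd' u hu (huv.trans hv)]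
    have : (u : ℚ) ≤ v := huv
    rcases hd with rfl | rfl
    · constructor <;> nlinarith
    · push_cast
      constructor <;> nlinarith
  obtain ⟨j, hj, hjt, hjt'⟩ := exists_cell k ht
  -- The one-cell estimate is chained over the cells that separate t from v.
  have key : ∀ n : ℕ, ∀ v : DyadicRat, t ≤ v → v ≤ dyadic (j + 1 + n) k →
      (c : ℚ) * (v - t) ≤ f v - f t ∧ f v - f t ≤ (c + 1) * (v - t) := by
    intro n
    induction n with
    | zero =>
      intro v hv hv'
      exact hcell j hj t v hjt hv (by simpa using hv')
    | succ n ih =>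
      intro v hv hv'
      rcases le_total v (dyadic (j + 1 + n) k) with h | h
      · exact ih v hv h
      · have h1 : t ≤ dyadic (j + 1 + n) k :=
          hjt'.le.trans ((dyadic_le_dyadic k).2 (by omega))
        obtain ⟨h2, h3⟩ := ih _ h1 le_rfl
        obtain ⟨h4, h5⟩ := hcell (j + 1 + n) (by omega) _ v le_rfl h
          (by rwa [Nat.cast_succ, ← add_assoc] at hv')
        constructor <;> linarith
  obtain ⟨j', hj', h1, h2⟩ := exists_cell k (ht.trans htt')
  refine key (j' - j).toNat t' htt' (h2.le.trans ((dyadic_le_dyadic k).2 ?_))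
  omega

/-- Two such functions cannot cross inside a cell: at its left end they differ by a multiple of
1/2^k, and their slopes differ by at most one. So one of them is the maximum on the whole cell, and
the grid needs no refinement. -/
theorem max (hf : GridAffine k c f) (hg : GridAffine k c g) :
    GridAffine k c fun t => max (f t) (g t) := by
  have hpos : (0 : ℚ) < (2 ^ k)⁻¹ := by positivity
  refine ⟨fun j hj => ?_, fun j hj => ?_⟩
  · rcases max_choice (f (dyadic j k)) (g (dyadic j k)) with h | h <;> rw [h]
    · exact hf.value j hj
    · exact hg.value j hj
  · have key : ∀ f g : DyadicRat → ℚ, GridAffine k c f → GridAffine k c g → ∀ d e : ℤ, e ≤ d →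
        (d = c ∨ d = c + 1) → (e = c ∨ e = c + 1) →
        (∀ t : DyadicRat, dyadic j k ≤ t → t ≤ dyadic (j + 1) k →
          f t = f (dyadic j k) + d * ((t : ℚ) - j * (2 ^ k)⁻¹)) →
        (∀ t : DyadicRat, dyadic j k ≤ t → t ≤ dyadic (j + 1) k →
          g t = g (dyadic j k) + e * ((t : ℚ) - j * (2 ^ k)⁻¹)) →
        ∃ d : ℤ, (d = c ∨ d = c + 1) ∧ ∀ t : DyadicRat, dyadic j k ≤ t → t ≤ dyadic (j + 1) k →
          Max.max (f t) (g t) = Max.max (f (dyadic j k)) (g (dyadic j k)) +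
            d * ((t : ℚ) - j * (2 ^ k)⁻¹) := by
      intro f g hf hg d e hed hd he hfd hge
      obtain ⟨n, hn⟩ := hf.value j hj
      obtain ⟨m, hm⟩ := hg.value j hj
      by_cases hmn : m ≤ n
      · refine ⟨d, hd, fun t ht ht' => ?_⟩
        have h1 : (m : ℚ) ≤ n := by exact_mod_cast hmn
        have h2 : (e : ℚ) ≤ d := by exact_mod_cast hed
        have h3 := dyadic_le_iff.1 ht
        have h4 : g (dyadic j k) ≤ f (dyadic j k) := by
          rw [hn, hm]
          gcongr
        rw [hfd t ht ht', hge t ht ht', max_eq_left h4, max_eq_left]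
        have : (e : ℚ) * ((t : ℚ) - j * (2 ^ k)⁻¹) ≤ d * ((t : ℚ) - j * (2 ^ k)⁻¹) := by
          apply mul_le_mul_of_nonneg_right h2
          linarith
        linarith
      -- Here g starts at least 1/2^k higher, and f gains at most the cell width 1/2^k.
      · refine ⟨e, he, fun t ht ht' => ?_⟩
        have h1 : (n : ℚ) + 1 ≤ m := by exact_mod_cast (by omega : n + 1 ≤ m)
        have h2 : (d : ℚ) ≤ e + 1 := by exact_mod_cast (by omega : d ≤ e + 1)
        have h3 := dyadic_le_iff.1 ht
        have h5 := le_dyadic_iff.1 ht'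
        have h4 : f (dyadic j k) + (2 ^ k)⁻¹ ≤ g (dyadic j k) := by
          rw [hn, hm]
          nlinarith
        have h6 : f (dyadic j k) ≤ g (dyadic j k) := by linarith
        rw [hfd t ht ht', hge t ht ht', max_eq_right h6, max_eq_right]
        have : (d : ℚ) * ((t : ℚ) - j * (2 ^ k)⁻¹) ≤ (e + 1) * ((t : ℚ) - j * (2 ^ k)⁻¹) := by
          apply mul_le_mul_of_nonneg_right h2
          linarith
        push_cast at h5
        linarith
    obtain ⟨d, hd, hfd⟩ := hf.cell j hj
    obtain ⟨e, he, hge⟩ := hg.cell j hj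
    rcases le_total e d with h | h
    · exact key f g hf hg d e h hd he hfd hge
    · obtain ⟨d', h1, h2⟩ := key g f hg hf e d h he hd hge hfd
      refine ⟨d', h1, fun t ht ht' => ?_⟩
      rw [max_comm, h2 t ht ht', max_comm (g _)]

theorem finset_sup' {ι : Type*} {s : Finset ι} (hs : s.Nonempty) {F : ι → DyadicRat → ℚ}
    (h : ∀ i ∈ s, ∃ k, GridAffine k c (F i)) :
    ∃ k, GridAffine k c fun t => s.sup' hs fun i => F i t := by
  induction hs using Finset.Nonempty.cons_induction with
  | singleton a => simpa using h a
  | cons a s ha hs ih =>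
    obtain ⟨k, hk⟩ := h a (Finset.mem_cons_self a s)
    obtain ⟨k', hk'⟩ := ih fun i hi => h i (Finset.mem_cons_of_mem hi)
    refine ⟨Max.max k k', ?_⟩
    refine ((hk.mono (le_max_left k k')).max (hk'.mono (le_max_right k k'))).congr fun t _ => ?_
    rw [Finset.sup'_cons hs]

theorem maxOf {m : ℕ} {F : Fin m → DyadicRat → ℚ} (i₀ : Fin m)
    (h : ∀ i, ∃ k, GridAffine k c (F i)) :
    ∃ k, GridAffine k c fun t => ShortGame.maxOf fun i => F i t := by
  have hne : (Finset.univ : Finset (Fin m)).Nonempty := ⟨i₀, Finset.mem_univ i₀⟩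
  simp only [ShortGame.maxOf, dif_pos hne]
  exact finset_sup' hne fun i _ => h i

theorem minOf {m : ℕ} {F : Fin m → DyadicRat → ℚ} (i₀ : Fin m)
    (h : ∀ i, ∃ k, GridAffine k c (F i)) :
    ∃ k, GridAffine k c fun t => ShortGame.minOf fun i => F i t := by
  obtain ⟨k, hk⟩ := maxOf i₀ fun i => let ⟨k, hk⟩ := h i; ⟨k, hk.neg⟩
  refine ⟨k, ?_⟩
  have h' := hk.neg
  rw [show -(-c - 1) - 1 = c by ring] at h'
  refine h'.congr fun t _ => ?_
  apply le_antisymm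
  · obtain ⟨i, hi⟩ := ShortGame.exists_minOf_eq (fun i => F i t) i₀
    rw [hi]
    linarith [ShortGame.le_maxOf (fun i => -F i t) i]
  · obtain ⟨i, hi⟩ := ShortGame.exists_maxOf_eq (fun i => -F i t) i₀
    rw [hi]
    linarith [ShortGame.minOf_le (fun i => F i t) i]

/-- A function that follows `f` up to a grid point and is constant from there on. -/
theorem freeze (hf : GridAffine k c f) (hc : 0 = c ∨ 0 = c + 1) {j₀ : ℤ}
    (h1 : ∀ t, -1 ≤ t → t ≤ dyadic j₀ k → g t = f t)
    (h2 : ∀ t, -1 ≤ t → dyadic j₀ k ≤ t → g t = f (dyadic j₀ k)) (hj₀ : -2 ^ k ≤ j₀) :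
    GridAffine k c g := by
  refine ⟨fun j hj => ?_, fun j hj => ?_⟩
  · rcases le_total (dyadic j k) (dyadic j₀ k) with h | h
    · rw [h1 _ (neg_one_le_dyadic.2 hj) h]
      exact hf.value j hj
    · rw [h2 _ (neg_one_le_dyadic.2 hj) h]
      exact hf.value j₀ hj₀
  · rcases le_or_gt j₀ j with h | h
    · refine ⟨0, hc, fun t ht ht' => ?_⟩
      have h3 := (dyadic_le_dyadic k).2 h
      have h4 := neg_one_le_dyadic.2 hj
      rw [h2 _ h4 h3, h2 _ (h4.trans ht) (h3.trans ht)]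
      simp
    · obtain ⟨d, hd, hd'⟩ := hf.cell j hj
      refine ⟨d, hd, fun t ht ht' => ?_⟩
      have h3 : dyadic (j + 1) k ≤ dyadic j₀ k := (dyadic_le_dyadic k).2 h
      have h4 := neg_one_le_dyadic.2 hj
      rw [h1 _ h4 (ht.trans (ht'.trans h3)), h1 _ (h4.trans ht) (ht'.trans h3)]
      exact hd' t ht ht'

/-- A wall of slopes `-1` and `0` that starts above a wall of slopes `0` and `1` either stays above
or meets it at a point of the next finer grid. -/
theorem crossing (hf : GridAffine k (-1) f) (hg : GridAffine k 0 g) :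
    (∀ t, -1 ≤ t → g t < f t) ∨ ∃ j : ℤ, -2 ^ (k + 1) ≤ j ∧
      (∀ t, -1 ≤ t → t < dyadic j (k + 1) → g t < f t) ∧
      f (dyadic j (k + 1)) ≤ g (dyadic j (k + 1)) ∧
      (dyadic j (k + 1) = -1 ∨ f (dyadic j (k + 1)) = g (dyadic j (k + 1))) := by
  have hpos : (0 : ℚ) < (2 ^ k)⁻¹ := by positivity
  have anti : ∀ t t' : DyadicRat, -1 ≤ t → t ≤ t' → f t' - g t' ≤ f t - g t := by
    intro t t' ht htt'
    have h1 := (hf.slope_bounds ht htt').2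
    have h2 := (hg.slope_bounds ht htt').1
    push_cast at h1 h2
    linarith
  by_cases hall : ∀ j : ℤ, -2 ^ k ≤ j → g (dyadic j k) < f (dyadic j k)
  · left
    intro t ht
    obtain ⟨j, hj, h1, h2⟩ := exists_cell k ht
    have h3 := anti t _ ht h2.le
    have h4 := hall (j + 1) (by omega)
    linarith
  right
  push Not at hall
  obtain ⟨i, ⟨hi, hi'⟩, hmin⟩ := Int.exists_least_of_bdd
    (P := fun j => -2 ^ k ≤ j ∧ f (dyadic j k) ≤ g (dyadic j k)) ⟨-2 ^ k, fun z hz => hz.1⟩ hall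
  rcases hi.eq_or_lt with rfl | hlt
  -- At -1 the functions may already have crossed; no equality is available there.
  · refine ⟨2 * -2 ^ k, ?_, ?_, ?_, ?_⟩
    · rw [pow_succ]
      omega
    · intro t ht ht'
      rw [dyadic_double, dyadic_neg_two_pow] at ht'
      exact absurd ht ht'.not_ge
    · rw [dyadic_double]
      exact hi'
    · left
      rw [dyadic_double, dyadic_neg_two_pow]
  have hp : g (dyadic (i - 1) k) < f (dyadic (i - 1) k) := by
    by_contra! h
    have := hmin (i - 1) ⟨by omega, h⟩
    omega
  have hi1 : -2 ^ k ≤ i - 1 := by omega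
  obtain ⟨n, hn⟩ := hf.value (i - 1) hi1
  obtain ⟨m, hm⟩ := hg.value (i - 1) hi1
  obtain ⟨d, hd, hd'⟩ := hf.cell (i - 1) hi1
  obtain ⟨e, he, he'⟩ := hg.cell (i - 1) hi1
  rw [sub_add_cancel] at hd' he'
  have hle : dyadic (i - 1) k ≤ dyadic i k := (dyadic_le_dyadic k).2 (by omega)
  have hmn : m < n := by
    rw [hn, hm] at hp
    exact_mod_cast lt_of_mul_lt_mul_right hp hpos.le
  have hnd : n + d ≤ m + e := by
    rw [hd' _ hle le_rfl, he' _ hle le_rfl, hn, hm, coe_dyadic_eq_mul] at hi'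
    have : ((n + d : ℤ) : ℚ) * (2 ^ k)⁻¹ ≤ ((m + e : ℤ) : ℚ) * (2 ^ k)⁻¹ := by
      push_cast at hi' ⊢
      linarith
    exact_mod_cast le_of_mul_le_mul_right this hpos
  have hdiff : ∀ t, dyadic (i - 1) k ≤ t → t ≤ dyadic i k →
      f t - g t = (n - m) * (2 ^ k)⁻¹ + (d - e) * (t - (i - 1) * (2 ^ k)⁻¹) := by
    intro t ht ht'
    rw [hd' t ht ht', he' t ht ht', hn, hm]
    push_cast
    ring
  have finish : ∀ j : ℤ, 2 * (i - 1) ≤ j → j ≤ 2 * i →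
      2 * (n - m) + (d - e) * (j - 2 * (i - 1)) = 0 →
      -2 ^ (k + 1) ≤ j ∧ (∀ t, -1 ≤ t → t < dyadic j (k + 1) → g t < f t) ∧
      f (dyadic j (k + 1)) ≤ g (dyadic j (k + 1)) ∧
      (dyadic j (k + 1) = -1 ∨ f (dyadic j (k + 1)) = g (dyadic j (k + 1))) := by
    intro j h1 h2 h3
    have hu := inv_two_pow_succ k
    have hj1 : dyadic (i - 1) k ≤ dyadic j (k + 1) := by
      rw [← dyadic_double, dyadic_le_dyadic]
      exact h1
    have hj2 : dyadic j (k + 1) ≤ dyadic i k := by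
      rw [← dyadic_double i, dyadic_le_dyadic]
      exact h2
    have h3' : 2 * ((n : ℚ) - m) + (d - e) * (j - 2 * (i - 1)) = 0 := by exact_mod_cast h3
    have heq : f (dyadic j (k + 1)) = g (dyadic j (k + 1)) := by
      have := hdiff _ hj1 hj2
      rw [coe_dyadic_eq_mul, hu] at this
      have h4 : f (dyadic j (k + 1)) - g (dyadic j (k + 1)) =
          (2 * ((n : ℚ) - m) + (d - e) * (j - 2 * (i - 1))) * (2 ^ (k + 1))⁻¹ := by
        rw [this]
        ring
      rw [h3', zero_mul] at h4
      linarith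
    refine ⟨by rw [pow_succ]; omega, fun t ht ht' => ?_, heq.le, Or.inr heq⟩
    have hde : (d : ℚ) - e < 0 := by
      have : d - e < 0 := by omega
      exact_mod_cast this
    rcases le_total t (dyadic (i - 1) k) with h | h
    · linarith [anti t _ ht h]
    · have h4 := hdiff t h (ht'.le.trans hj2)
      have h5 := hdiff _ hj1 hj2
      have h6 : (t : ℚ) < dyadic j (k + 1) := ht'
      nlinarith
  -- In units of 1/2^k, the gap n - m closes within this cell at rate 1 or 2. A gap of 1 at rate 2
  -- closes at the midpoint, which is why the finer grid is needed; otherwise the meeting point is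
  -- the right end.
  rcases (by omega : d - e = -1 ∧ n - m = 1 ∨ d - e = -2 ∧ n - m = 1 ∨ d - e = -2 ∧ n - m = 2) with
    ⟨h1, h2⟩ | ⟨h1, h2⟩ | ⟨h1, h2⟩
  · exact ⟨2 * i, finish _ (by omega) (by omega) (by rw [h1, h2]; ring)⟩
  · exact ⟨2 * i - 1, finish _ (by omega) (by omega) (by rw [h1, h2]; ring)⟩
  · exact ⟨2 * i, finish _ (by omega) (by omega) (by rw [h1, h2]; ring)⟩

end GridAffine

namespace ShortGame

/-! ### Cooling -/

/-- The left wall of the thermograph. -/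
def leftWall (G : ShortGame) (t : DyadicRat) : ℚ := LS (cool G t)

/-- The right wall of the thermograph. -/
def rightWall (G : ShortGame) (t : DyadicRat) : ℚ := RS (cool G t)

/-- The left scaffold: the left wall before the mast is drawn. -/
def leftScaffold : ShortGame → DyadicRat → ℚ
  | mk _ _ L _, t => maxOf fun i => rightWall (L i) t - t

/-- The right scaffold: the right wall before the mast is drawn. -/
def rightScaffold : ShortGame → DyadicRat → ℚ
  | mk _ _ _ R, t => minOf fun j => leftWall (R j) t + t

theorem rightWall_le_leftWall (G : ShortGame) (t : DyadicRat) : rightWall G t ≤ leftWall G t :=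
  RS_le_LS _

theorem sub_le_leftScaffold {X G : ShortGame} (h : IsL X G) (t : DyadicRat) :
    rightWall X t - t ≤ leftScaffold G t := by
  obtain ⟨m, n, L, R⟩ := G
  obtain ⟨i, rfl⟩ := h
  exact le_maxOf (fun i => rightWall (L i) t - t) i

theorem rightScaffold_le_add {X G : ShortGame} (h : IsR X G) (t : DyadicRat) :
    rightScaffold G t ≤ leftWall X t + t := by
  obtain ⟨m, n, L, R⟩ := G
  obtain ⟨i, rfl⟩ := h
  exact minOf_le (fun j => leftWall (R j) t + t) i

theorem exists_leftScaffold_eq {G : ShortGame} (hG : ¬ IsInteger G) (t : DyadicRat) :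
    ∃ X, IsL X G ∧ leftScaffold G t = rightWall X t - t := by
  obtain ⟨X, hX⟩ := exists_isL_of_not_isInteger hG
  obtain ⟨m, n, L, R⟩ := G
  obtain ⟨i, rfl⟩ := hX
  obtain ⟨i, hi⟩ := exists_maxOf_eq (fun i => rightWall (L i) t - t) i
  exact ⟨L i, ⟨i, rfl⟩, hi⟩

theorem exists_rightScaffold_eq {G : ShortGame} (hG : ¬ IsInteger G) (t : DyadicRat) :
    ∃ X, IsR X G ∧ rightScaffold G t = leftWall X t + t := by
  obtain ⟨X, hX⟩ := exists_isR_of_not_isInteger hG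
  obtain ⟨m, n, L, R⟩ := G
  obtain ⟨i, rfl⟩ := hX
  obtain ⟨i, hi⟩ := exists_minOf_eq (fun j => leftWall (R j) t + t) i
  exact ⟨R i, ⟨i, rfl⟩, hi⟩

theorem isInteger_iff_exists_valueEq {G : ShortGame} :
    IsInteger G ↔ ∃ n : ℤ, ValueEq G (intForm n) := by
  simp only [valueEq_iff, IsInteger]

theorem val_cool_of_isInteger {G : ShortGame} (hG : IsInteger G) (t : DyadicRat) :
    val (cool G t) = val G := by
  have h := isInteger_iff_exists_valueEq.1 hG
  obtain ⟨m, n, L, R⟩ := G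
  rw [cool, coolStep, dif_pos h]
  exact (valueEq_iff.1 h.choose_spec).symm

theorem walls_of_isInteger {G : ShortGame} {n : ℤ} (h : val G = val (intForm n))
    (t : DyadicRat) : leftWall G t = n ∧ rightWall G t = n := by
  have h1 : val (cool G t) = val (num (dyadic n 0)) := by
    rw [val_cool_of_isInteger ⟨n, h⟩, h, val_intForm]
  have h2 : ((dyadic n 0 : DyadicRat) : ℚ) = n := by simp [coe_dyadic]
  rw [leftWall, rightWall, LS_of_val_eq_num h1, RS_of_val_eq_num h1, h2]
  exact ⟨rfl, rfl⟩

/-- By `stops_mk` the uncooled-mast game T t is infinitesimally close to a number exactly when the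
scaffolds have met or crossed. `GridAffine.crossing` provides a least such point, which decides
every branch of `coolStep`. -/
theorem walls_cases_of {G : ShortGame} (hG : ¬ IsInteger G) {k : ℕ}
    (hl : GridAffine k (-1) (leftScaffold G)) (hr : GridAffine k 0 (rightScaffold G)) :
    (∀ t, -1 ≤ t → leftWall G t = leftScaffold G t ∧ rightWall G t = rightScaffold G t ∧
      rightScaffold G t < leftScaffold G t) ∨
    ∃ (j : ℤ) (z : DyadicRat), -2 ^ (k + 1) ≤ j ∧
      (∀ t, -1 ≤ t → t < dyadic j (k + 1) → leftWall G t = leftScaffold G t ∧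
        rightWall G t = rightScaffold G t ∧ rightScaffold G t < leftScaffold G t) ∧
      (∀ t, dyadic j (k + 1) ≤ t → leftWall G t = z ∧ rightWall G t = z) ∧
      leftScaffold G (dyadic j (k + 1)) ≤ z ∧ z ≤ rightScaffold G (dyadic j (k + 1)) ∧
      (dyadic j (k + 1) = -1 ∨
        leftScaffold G (dyadic j (k + 1)) = rightScaffold G (dyadic j (k + 1))) := by
  have hnotint := isInteger_iff_exists_valueEq.not.1 hG
  obtain ⟨X, hX⟩ := exists_isL_of_not_isInteger hG
  obtain ⟨Y, hY⟩ := exists_isR_of_not_isInteger hG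
  obtain ⟨m, n, L, R⟩ := G
  obtain ⟨i₀, -⟩ := hX
  obtain ⟨j₀, -⟩ := hY
  set T : DyadicRat → ShortGame := fun t =>
    mk m n (fun i => cool (L i) t - num t) (fun j => cool (R j) t + num t) with hT
  set l := leftScaffold (mk m n L R)
  set r := rightScaffold (mk m n L R)
  have hstops : ∀ t, (r t < l t → LS (T t) = l t ∧ RS (T t) = r t) ∧
      (l t ≤ r t → LS (T t) = RS (T t) ∧ l t ≤ LS (T t) ∧ LS (T t) ≤ r t) := by
    intro t
    refine stops_mk _ _ i₀ j₀ ?_ ?_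
    · simp only [(stops_sub_num _ _).2]
      rfl
    · simp only [LS_add_num]
      rfl
  have hS : ∀ t, (∃ y, InfClose (T t) (num y)) ↔ l t ≤ r t := by
    intro t
    rw [exists_infClose_num_iff]
    refine ⟨fun h => ?_, fun h => ((hstops t).2 h).1⟩
    by_contra! hlt
    obtain ⟨h1, h2⟩ := (hstops t).1 hlt
    rw [h1, h2] at h
    exact hlt.ne' h
  have hcool : ∀ t, cool (mk m n L R) t = coolStep (mk m n L R) T t := fun t => by rw [cool]
  have hset : {r : DyadicRat | -1 ≤ r ∧ ∃ y, InfClose (T r) (num y)} =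
      {t | -1 ≤ t ∧ l t ≤ r t} := by
    ext t
    simp only [Set.mem_ofPred_eq, hS]
  rcases hl.crossing hr with h | ⟨j, hj, hlt, hle, hor⟩
  · left
    intro t ht
    have : cool (mk m n L R) t = T t := by
      rw [hcool, coolStep, dif_neg hnotint, dif_neg]
      rintro ⟨x, s, hs, -, -⟩
      rw [hset] at hs
      exact (h s hs.1.1).not_ge hs.1.2
    rw [leftWall, rightWall, this]
    obtain ⟨h1, h2⟩ := (hstops t).1 (h t ht)
    exact ⟨h1, h2, h t ht⟩
  right
  set s := dyadic j (k + 1) with hs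
  have hs1 : -1 ≤ s := neg_one_le_dyadic.2 hj
  have hleast : IsLeast {r : DyadicRat | -1 ≤ r ∧ ∃ y, InfClose (T r) (num y)} s := by
    rw [hset]
    refine ⟨⟨hs1, hle⟩, fun t ht => ?_⟩
    by_contra! h
    exact (hlt t ht.1 h).not_ge ht.2
  obtain ⟨z, hz⟩ := (exists_stops_eq_coe (T s)).1
  obtain ⟨h1, h2, h3⟩ := (hstops s).2 hle
  -- At t = s the cooled game is still T s, because the mast clause asks for s < t; the wall values
  -- at s must therefore be read off T s.
  have hbefore : ∀ t, t ≤ s → cool (mk m n L R) t = T t := by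
    intro t ht
    rw [hcool, coolStep, dif_neg hnotint, dif_neg]
    rintro ⟨x, s', hs', hs't, -⟩
    rw [hs'.unique hleast] at hs't
    exact hs't.not_ge ht
  refine ⟨j, z, hj, fun t ht hts => ?_, fun t hst => ?_, ?_, ?_, hor⟩
  · rw [leftWall, rightWall, hbefore t hts.le]
    obtain ⟨h1, h2⟩ := (hstops t).1 (hlt t ht hts)
    exact ⟨h1, h2, hlt t ht hts⟩
  · rcases hst.eq_or_lt with rfl | hst
    · rw [leftWall, rightWall, hbefore _ le_rfl, ← h1, hz]
      exact ⟨rfl, rfl⟩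
    · have hex : ∃ x s : DyadicRat,
          IsLeast {r : DyadicRat | -1 ≤ r ∧ ∃ y, InfClose (T r) (num y)} s ∧ s < t ∧
            InfClose (T s) (num x) :=
        ⟨z, s, hleast, hst, infClose_num_iff.2 ⟨hz, h1 ▸ hz⟩⟩
      have hch : hex.choose = z := by
        obtain ⟨s', hs', -, hx⟩ := hex.choose_spec
        rw [hs'.unique hleast] at hx
        apply Subtype.ext
        rw [← hz, (infClose_num_iff.1 hx).1]
      have hc : cool (mk m n L R) t = num z := by
        rw [hcool, coolStep, dif_neg hnotint, dif_pos hex, hch]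
      rw [leftWall, rightWall, hc, LS_of_val_eq_num rfl, RS_of_val_eq_num rfl]
      exact ⟨rfl, rfl⟩
  · rw [← hz]
    exact h2
  · rw [← hz]
    exact h3

theorem walls_gridAffine_of {G : ShortGame} (hG : ¬ IsInteger G) {k : ℕ}
    (hl : GridAffine k (-1) (leftScaffold G)) (hr : GridAffine k 0 (rightScaffold G)) :
    ∃ k, GridAffine k (-1) (leftWall G) ∧ GridAffine k 0 (rightWall G) := by
  rcases walls_cases_of hG hl hr with h | ⟨j, z, hj, hlt, hge, hlz, hzr, hor | hor⟩
  · exact ⟨k, hl.congr fun t ht => (h t ht).1.symm, hr.congr fun t ht => (h t ht).2.1.symm⟩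
  -- A mast starting at -1 need not continue either scaffold, so the walls are constant on the whole
  -- range, on a grid that contains z.
  · rw [hor] at hge
    obtain ⟨a, k', rfl⟩ := exists_eq_dyadic z
    rw [coe_dyadic_eq_mul] at hge
    exact ⟨k', (GridAffine.const k' (by norm_num) a).congr fun t ht => (hge t ht).1.symm,
      (GridAffine.const k' (by norm_num) a).congr fun t ht => (hge t ht).2.symm⟩
  · have e1 : leftScaffold G (dyadic j (k + 1)) = z := le_antisymm hlz (hor ▸ hzr)
    have e2 : rightScaffold G (dyadic j (k + 1)) = z := hor ▸ e1
    refine ⟨k + 1, hl.succ.freeze (j₀ := j) (by norm_num) (fun t ht hts => ?_)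
      (fun t _ hst => ?_) hj, hr.succ.freeze (j₀ := j) (by norm_num) (fun t ht hts => ?_)
      (fun t _ hst => ?_) hj⟩
    · rcases hts.eq_or_lt with rfl | h
      · rw [e1, (hge _ le_rfl).1]
      · exact (hlt t ht h).1
    · rw [e1, (hge t hst).1]
    · rcases hts.eq_or_lt with rfl | h
      · rw [e2, (hge _ le_rfl).2]
      · exact (hlt t ht h).2.1
    · rw [e2, (hge t hst).2]

/-- The tax exchanges the slope ranges: slopes 0 and 1 become -1 and 0 after subtracting t, and the
reverse after adding t. -/
theorem scaffolds_gridAffine_of {m n : ℕ} {L : Fin m → ShortGame} {R : Fin n → ShortGame}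
    (hG : ¬ IsInteger (mk m n L R)) (ihL : ∀ i, ∃ k, GridAffine k 0 (rightWall (L i)))
    (ihR : ∀ j, ∃ k, GridAffine k (-1) (leftWall (R j))) :
    ∃ k, GridAffine k (-1) (leftScaffold (mk m n L R)) ∧
      GridAffine k 0 (rightScaffold (mk m n L R)) := by
  obtain ⟨X, i₀, -⟩ := exists_isL_of_not_isInteger hG
  obtain ⟨Y, j₀, -⟩ := exists_isR_of_not_isInteger hG
  obtain ⟨k₁, h₁⟩ := GridAffine.maxOf (c := -1) (F := fun i t => rightWall (L i) t - t) i₀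
    fun i => let ⟨k, hk⟩ := ihL i; ⟨k, hk.sub_id⟩
  obtain ⟨k₂, h₂⟩ := GridAffine.minOf (c := 0) (F := fun j t => leftWall (R j) t + t) j₀
    fun j => let ⟨k, hk⟩ := ihR j; ⟨k, hk.add_id⟩
  exact ⟨max k₁ k₂, h₁.mono (le_max_left _ _), h₂.mono (le_max_right _ _)⟩

theorem exists_walls_gridAffine (G : ShortGame) :
    ∃ k, GridAffine k (-1) (leftWall G) ∧ GridAffine k 0 (rightWall G) := by
  induction G with
  | mk m n L R ihL ihR =>
    by_cases hG : IsInteger (mk m n L R)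
    · obtain ⟨n, hn⟩ := hG
      exact ⟨0, (GridAffine.const 0 (by norm_num) n).congr fun t _ => by
          simp [(walls_of_isInteger hn t).1],
        (GridAffine.const 0 (by norm_num) n).congr fun t _ => by
          simp [(walls_of_isInteger hn t).2]⟩
    · obtain ⟨k, hl, hr⟩ := scaffolds_gridAffine_of hG (fun i => (ihL i).imp fun _ h => h.2)
        fun i => (ihR i).imp fun _ h => h.1
      exact walls_gridAffine_of hG hl hr

theorem exists_scaffolds_gridAffine {G : ShortGame} (hG : ¬ IsInteger G) :
    ∃ k, GridAffine k (-1) (leftScaffold G) ∧ GridAffine k 0 (rightScaffold G) := by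
  obtain ⟨m, n, L, R⟩ := G
  exact scaffolds_gridAffine_of hG
    (fun i => (exists_walls_gridAffine (L i)).imp fun _ h => h.2)
    fun i => (exists_walls_gridAffine (R i)).imp fun _ h => h.1

/-- The walls follow the scaffolds as long as the scaffolds have not met, and are constant from then
on. -/
theorem walls_cases {G : ShortGame} (hG : ¬ IsInteger G) :
    (∀ t, -1 ≤ t → leftWall G t = leftScaffold G t ∧ rightWall G t = rightScaffold G t ∧
      rightScaffold G t < leftScaffold G t) ∨
    ∃ s z : DyadicRat, -1 ≤ s ∧
      (∀ t, -1 ≤ t → t < s → leftWall G t = leftScaffold G t ∧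
        rightWall G t = rightScaffold G t ∧ rightScaffold G t < leftScaffold G t) ∧
      (∀ t, s ≤ t → leftWall G t = z ∧ rightWall G t = z) ∧
      leftScaffold G s ≤ z ∧ z ≤ rightScaffold G s ∧
      (s = -1 ∨ leftScaffold G s = rightScaffold G s) := by
  obtain ⟨k, hl, hr⟩ := exists_scaffolds_gridAffine hG
  refine (walls_cases_of hG hl hr).imp id ?_
  rintro ⟨j, z, hj, h⟩
  exact ⟨_, z, neg_one_le_dyadic.2 hj, h⟩

theorem leftWall_anti (G : ShortGame) {t t' : DyadicRat} (ht : -1 ≤ t) (h : t ≤ t') :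
    leftWall G t' ≤ leftWall G t := by
  obtain ⟨k, hk, -⟩ := exists_walls_gridAffine G
  have := (hk.slope_bounds ht h).2
  push_cast at this
  linarith

theorem leftScaffold_anti {G : ShortGame} (hG : ¬ IsInteger G) {t t' : DyadicRat} (ht : -1 ≤ t)
    (h : t ≤ t') : leftScaffold G t' ≤ leftScaffold G t := by
  obtain ⟨k, hk, -⟩ := exists_scaffolds_gridAffine hG
  have := (hk.slope_bounds ht h).2
  push_cast at this
  linarith

theorem rightScaffold_mono {G : ShortGame} (hG : ¬ IsInteger G) {t t' : DyadicRat} (ht : -1 ≤ t)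
    (h : t ≤ t') : rightScaffold G t ≤ rightScaffold G t' := by
  obtain ⟨k, -, hk⟩ := exists_scaffolds_gridAffine hG
  have := (hk.slope_bounds ht h).1
  push_cast at this
  linarith

/-- Beyond the foot of the mast the scaffold keeps falling or stays level, while the wall stays at
z. -/
theorem leftScaffold_le_leftWall {G : ShortGame} (hG : ¬ IsInteger G) {t : DyadicRat}
    (ht : -1 ≤ t) : leftScaffold G t ≤ leftWall G t := by
  rcases walls_cases hG with h | ⟨s, z, hs, hlt, hge, hlz, -, -⟩
  · exact (h t ht).1.ge
  · rcases lt_or_ge t s with h | h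
    · exact (hlt t ht h).1.ge
    · rw [(hge t h).1]
      exact (leftScaffold_anti hG hs h).trans hlz

theorem rightWall_le_rightScaffold {G : ShortGame} (hG : ¬ IsInteger G) {t : DyadicRat}
    (ht : -1 ≤ t) : rightWall G t ≤ rightScaffold G t := by
  rcases walls_cases hG with h | ⟨s, z, hs, hlt, hge, -, hzr, -⟩
  · exact (h t ht).2.1.le
  · rcases lt_or_ge t s with h | h
    · exact (hlt t ht h).2.1.le
    · rw [(hge t h).2]
      exact hzr.trans (rightScaffold_mono hG hs h)

/-! ### Cooling by a small negative amount preserves bounds by numbers -/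

theorem num_le_of_isR_dyadicForm {X : ShortGame} {m : ℤ} {k : ℕ} (h : IsR X (dyadicForm m k)) :
    val (num (dyadic (m + 1) k)) ≤ val X := by
  rw [val_num_dyadic]
  exact ((dyadicForm_spec k m).2.2 X h).1

theorem le_num_of_isL_dyadicForm {X : ShortGame} {m : ℤ} {k : ℕ} (h : IsL X (dyadicForm m k)) :
    val X ≤ val (num (dyadic (m - 1) k)) := by
  rw [val_num_dyadic]
  exact ((dyadicForm_spec k m).2.1 X h).1

theorem neg_one_le_of_neg_inv_two_pow_le {k : ℕ} {t : DyadicRat} (ht : -(2 ^ k : ℚ)⁻¹ ≤ t) :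
    -1 ≤ t := by
  have h : (2 ^ k : ℚ)⁻¹ ≤ 1 := inv_le_one_of_one_le₀ (one_le_pow₀ (by norm_num))
  change (-1 : ℚ) ≤ t
  linarith

/-- An integer is a multiple of 1/2^k, so exceeding m/2^k means exceeding it by a full step. -/
theorem not_num_le_of_intForm {Y : ShortGame} {n m : ℤ} {k : ℕ} (hn : val Y = val (intForm n))
    (h : ¬ val Y ≤ val (num (dyadic m k))) : ((m : ℚ) + 1) * (2 ^ k)⁻¹ ≤ n := by
  rw [hn, val_intForm, val_num_le, ← dyadic_mul_two_pow n 0 k, zero_add, dyadic_le_dyadic] at h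
  have h1 : (m : ℚ) + 1 ≤ n * 2 ^ k := by exact_mod_cast (by omega : m + 1 ≤ n * 2 ^ k)
  rwa [← div_eq_mul_inv, div_le_iff₀ (by positivity)]

theorem not_le_num_of_intForm {Y : ShortGame} {n m : ℤ} {k : ℕ} (hn : val Y = val (intForm n))
    (h : ¬ val (num (dyadic m k)) ≤ val Y) : (n : ℚ) ≤ ((m : ℚ) - 1) * (2 ^ k)⁻¹ := by
  rw [hn, val_intForm, val_num_le, ← dyadic_mul_two_pow n 0 k, zero_add, dyadic_le_dyadic] at h
  have h1 : (n : ℚ) * 2 ^ k ≤ m - 1 := by exact_mod_cast (by omega : n * 2 ^ k ≤ m - 1)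
  rwa [← div_eq_mul_inv, le_div_iff₀ (by positivity)]

/-- If cooling by `t` preserves the lower bound `m / 2 ^ k` of the Left options of `Y` and the lower
bound `(m + 1) / 2 ^ k` of `Y`, then the left wall of a game `Y` that is not at most `m / 2 ^ k` is at
least `m / 2 ^ k - t`. -/
theorem le_leftWall_add_of {Y : ShortGame} {m : ℤ} {k : ℕ} {t : DyadicRat}
    (ht : -(2 ^ k : ℚ)⁻¹ ≤ t)
    (ihL : ∀ X, IsL X Y → val (num (dyadic m k)) ≤ val X → (m : ℚ) * (2 ^ k)⁻¹ ≤ rightWall X t)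
    (ihY : val (num (dyadic (m + 1) k)) ≤ val Y → ((m : ℚ) + 1) * (2 ^ k)⁻¹ ≤ rightWall Y t)
    (h : ¬ val Y ≤ val (num (dyadic m k))) : (m : ℚ) * (2 ^ k)⁻¹ ≤ leftWall Y t + t := by
  by_cases hY : IsInteger Y
  · obtain ⟨n, hn⟩ := hY
    have := not_num_le_of_intForm hn h
    rw [(walls_of_isInteger hn t).1]
    linarith
  · rw [val_num_dyadic_eq] at h
    rcases not_le_iff.1 h with ⟨X, hX, hle⟩ | ⟨X, hX, hle⟩
    · have h1 := ihL X hX (by rw [val_num_dyadic_eq]; exact hle)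
      have h2 := sub_le_leftScaffold hX t
      have h3 := leftScaffold_le_leftWall hY (neg_one_le_of_neg_inv_two_pow_le ht)
      linarith
    -- A Right option of m/2^k is larger by at least 1/2^k, which pays for adding the negative t.
    · have h1 := ihY ((num_le_of_isR_dyadicForm hX).trans (val_le.2 hle))
      have h2 := rightWall_le_leftWall Y t
      linarith

theorem rightWall_sub_le_of {Y : ShortGame} {m : ℤ} {k : ℕ} {t : DyadicRat}
    (ht : -(2 ^ k : ℚ)⁻¹ ≤ t)
    (ihR : ∀ X, IsR X Y → val X ≤ val (num (dyadic m k)) → leftWall X t ≤ (m : ℚ) * (2 ^ k)⁻¹)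
    (ihY : val Y ≤ val (num (dyadic (m - 1) k)) → leftWall Y t ≤ ((m : ℚ) - 1) * (2 ^ k)⁻¹)
    (h : ¬ val (num (dyadic m k)) ≤ val Y) : rightWall Y t - t ≤ (m : ℚ) * (2 ^ k)⁻¹ := by
  by_cases hY : IsInteger Y
  · obtain ⟨n, hn⟩ := hY
    have := not_le_num_of_intForm hn h
    rw [(walls_of_isInteger hn t).2]
    linarith
  · rw [val_num_dyadic_eq] at h
    rcases not_le_iff.1 h with ⟨X, hX, hle⟩ | ⟨X, hX, hle⟩
    · have h1 := ihY ((val_le.2 hle).trans (le_num_of_isL_dyadicForm hX))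
      have h2 := rightWall_le_leftWall Y t
      linarith
    · have h1 := ihR X hX (by rw [val_num_dyadic_eq]; exact hle)
      have h2 := rightScaffold_le_add hX t
      have h3 := rightWall_le_rightScaffold hY (neg_one_le_of_neg_inv_two_pow_le ht)
      linarith

/-- Cooling by `t ≥ -1 / 2 ^ k` preserves lower bounds that are multiples of `1 / 2 ^ k`. -/
theorem le_rightWall_of_num_le {G : ShortGame} {k : ℕ} {m : ℤ} {t : DyadicRat}
    (ht : -(2 ^ k : ℚ)⁻¹ ≤ t) (ht0 : t ≤ 0) (h : val (num (dyadic m k)) ≤ val G) :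
    (m : ℚ) * (2 ^ k)⁻¹ ≤ rightWall G t := by
  -- Right options of G are only known not to be at most m/2^k, so the induction also carries a
  -- statement about their left walls.
  suffices H : ∀ G : ShortGame, (∀ (k : ℕ) (m : ℤ) (t : DyadicRat), -(2 ^ k : ℚ)⁻¹ ≤ t → t ≤ 0 →
      val (num (dyadic m k)) ≤ val G → (m : ℚ) * (2 ^ k)⁻¹ ≤ rightWall G t) ∧
      ∀ (k : ℕ) (m : ℤ) (t : DyadicRat), -(2 ^ k : ℚ)⁻¹ ≤ t → t ≤ 0 →
      ¬ val G ≤ val (num (dyadic m k)) → (m : ℚ) * (2 ^ k)⁻¹ ≤ leftWall G t + t from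
    (H G).1 k m t ht ht0 h
  clear h ht0 ht t m k G
  intro G
  induction G using option_induction with
  | h G ihL ihR =>
    suffices H : ∀ (k : ℕ) (m : ℤ) (t : DyadicRat), -(2 ^ k : ℚ)⁻¹ ≤ t → t ≤ 0 →
        val (num (dyadic m k)) ≤ val G → (m : ℚ) * (2 ^ k)⁻¹ ≤ rightWall G t by
      refine ⟨H, fun k m t ht ht0 h => ?_⟩
      refine le_leftWall_add_of ht (fun X hX hle => (ihL X hX).1 k m t ht ht0 hle) (fun hle => ?_) h
      have := H k (m + 1) t ht ht0 hle
      rwa [Int.cast_add, Int.cast_one] at this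
    by_cases hG : IsInteger G
    · intro k m t ht ht0 h
      obtain ⟨n, hn⟩ := hG
      rw [(walls_of_isInteger hn t).2]
      rw [hn, val_intForm, val_num_le] at h
      have h' : (dyadic m k : ℚ) ≤ dyadic n 0 := h
      rw [coe_dyadic_eq_mul] at h'
      simpa [coe_dyadic] using h'
    have hr : ∀ (k : ℕ) (m : ℤ) (t : DyadicRat), -(2 ^ k : ℚ)⁻¹ ≤ t → t ≤ 0 →
        val (num (dyadic m k)) ≤ val G → (m : ℚ) * (2 ^ k)⁻¹ ≤ rightScaffold G t := by
      intro k m t ht ht0 h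
      obtain ⟨Y, hY, hY'⟩ := exists_rightScaffold_eq hG t
      rw [hY']
      exact (ihR Y hY).2 k m t ht ht0 fun hle => not_val_le_of_isR hY (hle.trans h)
    -- It remains to bound the mast value `z` when the mast starts at some `s ≤ -1 / 2 ^ k`.
    have reduce : ∀ (k : ℕ) (m : ℤ) (t : DyadicRat), -(2 ^ k : ℚ)⁻¹ ≤ t → t ≤ 0 →
        val (num (dyadic m k)) ≤ val G → (∀ s : DyadicRat, -1 ≤ s → s ≤ t → (s : ℚ) ≤ -(2 ^ k : ℚ)⁻¹ →
          (m : ℚ) * (2 ^ k)⁻¹ ≤ leftScaffold G s) → (m : ℚ) * (2 ^ k)⁻¹ ≤ rightWall G t := by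
      intro k m t ht ht0 h hs
      have ht1 := neg_one_le_of_neg_inv_two_pow_le ht
      rcases walls_cases hG with h' | ⟨s, z, hs1, hlt, hge, hlz, hzr, hor⟩
      · rw [(h' t ht1).2.1]
        exact hr k m t ht ht0 h
      rcases lt_or_ge t s with hts | hst
      · rw [(hlt t ht1 hts).2.1]
        exact hr k m t ht ht0 h
      rw [(hge t hst).2]
      rcases le_or_gt (s : ℚ) (-(2 ^ k : ℚ)⁻¹) with hsk | hsk
      · exact (hs s hs1 hst hsk).trans hlz
      -- Now s > -1/2^k ≥ -1, so the scaffolds meet exactly at s and the bound on the right scaffold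
      -- passes to z.
      · rcases hor with rfl | hor
        · have : (2 ^ k : ℚ)⁻¹ ≤ 1 := inv_le_one_of_one_le₀ (one_le_pow₀ (by norm_num))
          push_cast at hsk
          linarith
        · refine le_trans ?_ hlz
          rw [hor]
          exact hr k m s hsk.le (hst.trans ht0) h
    intro k
    induction k with
    | zero =>
      intro m t ht ht0 h
      refine reduce 0 m t ht ht0 h fun s hs1 hst hsk => ?_
      obtain ⟨n, hn, X, hX, hle⟩ := exists_int_le_isL hG
      have hmn : m ≤ n := by
        by_contra! hlt
        apply hn
        rw [val_intForm]
        exact (val_num_le.2 ((dyadic_le_dyadic 0).2 (by omega))).trans h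
      rw [val_intForm] at hle
      have h1 := (ihL X hX).1 0 n t ht ht0 hle
      have h2 := sub_le_leftScaffold hX t
      have h3 := leftScaffold_anti hG hs1 hst
      have h4 : (t : ℚ) ≤ 0 := ht0
      have h5 : (m : ℚ) ≤ n := by exact_mod_cast hmn
      simp only [pow_zero, inv_one, mul_one] at h1 ⊢
      linarith
    | succ k ih =>
      intro m t ht ht0 h
      have hu := inv_two_pow_succ k
      have hpos : (0 : ℚ) < (2 ^ (k + 1))⁻¹ := by positivity
      have ht' : -(2 ^ k : ℚ)⁻¹ ≤ t := by linarith
      obtain ⟨a, rfl | rfl⟩ := Int.even_or_odd' m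
      · rw [dyadic_double] at h
        have := ih a t ht' ht0 h
        rw [hu] at this
        push_cast
        linarith
      have hD := h
      rw [val_num_dyadic_eq, dyadicForm_odd] at hD
      -- The bound is {a/2^k | (a+1)/2^k}, so G is not at most a/2^k. Either a Left option of G
      -- reaches a/2^k, or G is at least a Right option of a/2^k, hence at least (a+1)/2^k, and the
      -- coarser grid already gives more.
      have hG1 : ¬ G ≤ dyadicForm a k := fun hle =>
        not_val_le_of_isL (isL_ofPair.2 rfl) (hD.trans hle)
      rcases not_le_iff.1 hG1 with ⟨X, hX, hle⟩ | ⟨X, hX, hle⟩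
      · refine reduce (k + 1) _ t ht ht0 h fun s hs1 hst hsk => ?_
        have hle' : val (num (dyadic a k)) ≤ val X := by
          rw [val_num_dyadic_eq]
          exact hle
        -- The point t' stays in the range -1/2^k ≤ t' where the bound a/2^k of X is preserved, yet
        -- is low enough that subtracting it adds the missing 1/2^(k+1).
        set t' : DyadicRat := max s (dyadic (-1) k) with ht'
        have hd : ((dyadic (-1) k : DyadicRat) : ℚ) = -(2 ^ k)⁻¹ := by
          rw [coe_dyadic_eq_mul]
          push_cast
          ring
        have hst' : s ≤ t' := le_max_left _ _
        have ht'1 : (t' : ℚ) ≤ -(2 ^ (k + 1))⁻¹ := by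
          rcases max_choice s (dyadic (-1) k) with h | h <;> rw [ht', h]
          · exact hsk
          · rw [hd]
            linarith
        have ht'2 : -(2 ^ k : ℚ)⁻¹ ≤ t' := by
          rw [← hd]
          exact le_max_right s (dyadic (-1) k)
        have ht'0 : t' ≤ 0 := by
          change (t' : ℚ) ≤ 0
          linarith
        have h1 := (ihL X hX).1 k a t' ht'2 ht'0 hle'
        have h2 := sub_le_leftScaffold hX t'
        have h3 := leftScaffold_anti hG hs1 hst'
        rw [hu] at h1
        push_cast
        linarith
      · have := ih (a + 1) t ht' ht0 ((num_le_of_isR_dyadicForm hX).trans (val_le.2 hle))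
        rw [hu] at this
        push_cast at this ⊢
        linarith

/-- Cooling by `t ≥ -1 / 2 ^ k` preserves upper bounds that are multiples of `1 / 2 ^ k`. -/
theorem leftWall_le_of_le_num {G : ShortGame} {k : ℕ} {m : ℤ} {t : DyadicRat}
    (ht : -(2 ^ k : ℚ)⁻¹ ≤ t) (ht0 : t ≤ 0) (h : val G ≤ val (num (dyadic m k))) :
    leftWall G t ≤ (m : ℚ) * (2 ^ k)⁻¹ := by
  suffices H : ∀ G : ShortGame, (∀ (k : ℕ) (m : ℤ) (t : DyadicRat), -(2 ^ k : ℚ)⁻¹ ≤ t → t ≤ 0 →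
      val G ≤ val (num (dyadic m k)) → leftWall G t ≤ (m : ℚ) * (2 ^ k)⁻¹) ∧
      ∀ (k : ℕ) (m : ℤ) (t : DyadicRat), -(2 ^ k : ℚ)⁻¹ ≤ t → t ≤ 0 →
      ¬ val (num (dyadic m k)) ≤ val G → rightWall G t - t ≤ (m : ℚ) * (2 ^ k)⁻¹ from
    (H G).1 k m t ht ht0 h
  clear h ht0 ht t m k G
  intro G
  induction G using option_induction with
  | h G ihL ihR =>
    suffices H : ∀ (k : ℕ) (m : ℤ) (t : DyadicRat), -(2 ^ k : ℚ)⁻¹ ≤ t → t ≤ 0 →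
        val G ≤ val (num (dyadic m k)) → leftWall G t ≤ (m : ℚ) * (2 ^ k)⁻¹ by
      refine ⟨H, fun k m t ht ht0 h => ?_⟩
      refine rightWall_sub_le_of ht (fun X hX hle => (ihR X hX).1 k m t ht ht0 hle)
        (fun hle => ?_) h
      have := H k (m - 1) t ht ht0 hle
      rwa [Int.cast_sub, Int.cast_one] at this
    by_cases hG : IsInteger G
    · intro k m t ht ht0 h
      obtain ⟨n, hn⟩ := hG
      rw [(walls_of_isInteger hn t).1]
      rw [hn, val_intForm, val_num_le] at h
      have h' : (dyadic n 0 : ℚ) ≤ dyadic m k := h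
      rw [coe_dyadic_eq_mul m] at h'
      simpa [coe_dyadic] using h'
    have hr : ∀ (k : ℕ) (m : ℤ) (t : DyadicRat), -(2 ^ k : ℚ)⁻¹ ≤ t → t ≤ 0 →
        val G ≤ val (num (dyadic m k)) → leftScaffold G t ≤ (m : ℚ) * (2 ^ k)⁻¹ := by
      intro k m t ht ht0 h
      obtain ⟨Y, hY, hY'⟩ := exists_leftScaffold_eq hG t
      rw [hY']
      exact (ihL Y hY).2 k m t ht ht0 fun hle => not_val_le_of_isL hY (h.trans hle)
    have reduce : ∀ (k : ℕ) (m : ℤ) (t : DyadicRat), -(2 ^ k : ℚ)⁻¹ ≤ t → t ≤ 0 →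
        val G ≤ val (num (dyadic m k)) → (∀ s : DyadicRat, -1 ≤ s → s ≤ t → (s : ℚ) ≤ -(2 ^ k : ℚ)⁻¹ →
          rightScaffold G s ≤ (m : ℚ) * (2 ^ k)⁻¹) → leftWall G t ≤ (m : ℚ) * (2 ^ k)⁻¹ := by
      intro k m t ht ht0 h hs
      have ht1 := neg_one_le_of_neg_inv_two_pow_le ht
      rcases walls_cases hG with h' | ⟨s, z, hs1, hlt, hge, hlz, hzr, hor⟩
      · rw [(h' t ht1).1]
        exact hr k m t ht ht0 h
      rcases lt_or_ge t s with hts | hst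
      · rw [(hlt t ht1 hts).1]
        exact hr k m t ht ht0 h
      rw [(hge t hst).1]
      rcases le_or_gt (s : ℚ) (-(2 ^ k : ℚ)⁻¹) with hsk | hsk
      · exact hzr.trans (hs s hs1 hst hsk)
      · rcases hor with rfl | hor
        · have : (2 ^ k : ℚ)⁻¹ ≤ 1 := inv_le_one_of_one_le₀ (one_le_pow₀ (by norm_num))
          push_cast at hsk
          linarith
        · refine hzr.trans ?_
          rw [← hor]
          exact hr k m s hsk.le (hst.trans ht0) h
    intro k
    induction k with
    | zero =>
      intro m t ht ht0 h
      refine reduce 0 m t ht ht0 h fun s hs1 hst hsk => ?_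
      obtain ⟨n, hn, X, hX, hle⟩ := exists_int_ge_isR hG
      have hmn : n ≤ m := by
        by_contra! hlt
        apply hn
        rw [val_intForm]
        exact h.trans (val_num_le.2 ((dyadic_le_dyadic 0).2 (by omega)))
      rw [val_intForm] at hle
      have h1 := (ihR X hX).1 0 n t ht ht0 hle
      have h2 := rightScaffold_le_add hX t
      have h3 := rightScaffold_mono hG hs1 hst
      have h4 : (t : ℚ) ≤ 0 := ht0
      have h5 : (n : ℚ) ≤ m := by exact_mod_cast hmn
      simp only [pow_zero, inv_one, mul_one] at h1 ⊢
      linarith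
    | succ k ih =>
      intro m t ht ht0 h
      have hu := inv_two_pow_succ k
      have hpos : (0 : ℚ) < (2 ^ (k + 1))⁻¹ := by positivity
      have ht' : -(2 ^ k : ℚ)⁻¹ ≤ t := by linarith
      obtain ⟨a, rfl | rfl⟩ := Int.even_or_odd' m
      · rw [dyadic_double] at h
        have := ih a t ht' ht0 h
        rw [hu] at this
        push_cast
        linarith
      have hD := h
      rw [val_num_dyadic_eq, dyadicForm_odd] at hD
      -- The mirror image: G is at most {a/2^k | (a+1)/2^k}, so it is not at least the Right option.
      have hG1 : ¬ dyadicForm (a + 1) k ≤ G := fun hle =>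
        not_val_le_of_isR (isR_ofPair.2 rfl) (le_trans hle hD)
      rcases not_le_iff.1 hG1 with ⟨X, hX, hle⟩ | ⟨X, hX, hle⟩
      · have h1 := le_num_of_isL_dyadicForm hX
        rw [add_sub_cancel_right] at h1
        have := ih a t ht' ht0 ((val_le.2 hle).trans h1)
        rw [hu] at this
        push_cast at this ⊢
        linarith
      · refine reduce (k + 1) _ t ht ht0 h fun s hs1 hst hsk => ?_
        have hle' : val X ≤ val (num (dyadic (a + 1) k)) := by
          rw [val_num_dyadic_eq]
          exact hle
        set t' : DyadicRat := max s (dyadic (-1) k) with ht'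
        have hd : ((dyadic (-1) k : DyadicRat) : ℚ) = -(2 ^ k)⁻¹ := by
          rw [coe_dyadic_eq_mul]
          push_cast
          ring
        have hst' : s ≤ t' := le_max_left _ _
        have ht'1 : (t' : ℚ) ≤ -(2 ^ (k + 1))⁻¹ := by
          rcases max_choice s (dyadic (-1) k) with h | h <;> rw [ht', h]
          · exact hsk
          · rw [hd]
            linarith
        have ht'2 : -(2 ^ k : ℚ)⁻¹ ≤ t' := by
          rw [← hd]
          exact le_max_right s (dyadic (-1) k)
        have ht'0 : t' ≤ 0 := by
          change (t' : ℚ) ≤ 0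
          linarith
        have h1 := (ihR X hX).1 k (a + 1) t' ht'2 ht'0 hle'
        have h2 := rightScaffold_le_add hX t'
        have h3 := rightScaffold_mono hG hs1 hst'
        rw [hu] at h1
        push_cast at h1 ⊢
        linarith

/-! ### Cooling by zero -/

/-- A number is its own lower and upper bound, and zero is in the range where cooling preserves
both. -/
theorem walls_zero_of_isNumber {G : ShortGame} (hG : IsNumber G) :
    leftWall G 0 = LS G ∧ rightWall G 0 = RS G := by
  obtain ⟨x, hx⟩ := hG
  rw [LS_of_val_eq_num hx, RS_of_val_eq_num hx]
  obtain ⟨m, k, rfl⟩ := exists_eq_dyadic x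
  have h0 : -(2 ^ k : ℚ)⁻¹ ≤ (0 : DyadicRat) := by
    have : (0 : ℚ) < (2 ^ k)⁻¹ := by positivity
    push_cast
    linarith
  have h1 := le_rightWall_of_num_le h0 le_rfl hx.ge
  have h2 := leftWall_le_of_le_num h0 le_rfl hx.le
  have h3 := rightWall_le_leftWall G 0
  rw [coe_dyadic_eq_mul]
  constructor <;> linarith

/-- A game whose mast starts below temperature zero is a number. -/
theorem isNumber_of_mast_neg {G : ShortGame} {s z : DyadicRat} (hG : ¬ IsInteger G) (hs1 : -1 ≤ s)
    (hs0 : s < 0) (hl : leftScaffold G s ≤ z) (hr : z ≤ rightScaffold G s) : IsNumber G := by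
  obtain ⟨m, k, rfl⟩ := exists_eq_dyadic z
  rw [coe_dyadic_eq_mul] at hl hr
  -- At this t bounds by z are preserved, and t is strictly negative. A Left option at least z would
  -- lift the left scaffold at t to z - t > z, above its value at s; dually for Right options. So z
  -- fits.
  set t : DyadicRat := max s (dyadic (-1) k) with ht
  have hd : ((dyadic (-1) k : DyadicRat) : ℚ) = -(2 ^ k)⁻¹ := by
    rw [coe_dyadic_eq_mul]
    push_cast
    ring
  have hst : s ≤ t := le_max_left _ _
  have ht1 : -(2 ^ k : ℚ)⁻¹ ≤ t := by
    rw [← hd]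
    exact le_max_right s (dyadic (-1) k)
  have ht0 : (t : ℚ) < 0 := by
    rcases max_choice s (dyadic (-1) k) with h | h <;> rw [ht, h]
    · exact hs0
    · rw [hd]
      have : (0 : ℚ) < (2 ^ k)⁻¹ := by positivity
      linarith
  refine isNumber_of_fits (x := dyadic m k) (fun X hX hle => ?_) fun X hX hle => ?_
  · have h1 := le_rightWall_of_num_le ht1 ht0.le hle
    have h2 := sub_le_leftScaffold hX t
    have h3 := leftScaffold_anti hG hs1 hst
    linarith
  · have h1 := leftWall_le_of_le_num ht1 ht0.le hle
    have h2 := rightScaffold_le_add hX t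
    have h3 := rightScaffold_mono hG hs1 hst
    linarith

theorem walls_zero (G : ShortGame) : leftWall G 0 = LS G ∧ rightWall G 0 = RS G := by
  induction G using option_induction with
  | h G ihL ihR =>
    by_cases hG : IsNumber G
    · exact walls_zero_of_isNumber hG
    have hint : ¬ IsInteger G := fun h => hG h.isNumber
    have hl : leftScaffold G 0 = LS G := by
      apply le_antisymm
      · obtain ⟨X, hX, h⟩ := exists_leftScaffold_eq hint 0
        rw [h, (ihL X hX).2]
        simpa using RS_le_LS_of_isL hG hX
      · obtain ⟨X, hX, h⟩ := exists_LS_eq hG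
        rw [h, ← (ihL X hX).2]
        simpa using sub_le_leftScaffold hX 0
    have hr : rightScaffold G 0 = RS G := by
      apply le_antisymm
      · obtain ⟨X, hX, h⟩ := exists_RS_eq hG
        rw [h, ← (ihR X hX).1]
        simpa using rightScaffold_le_add hX 0
      · obtain ⟨X, hX, h⟩ := exists_rightScaffold_eq hint 0
        rw [h, (ihR X hX).1]
        simpa using RS_le_LS_of_isR hG hX
    have h01 : (-1 : DyadicRat) ≤ 0 := by
      change (-1 : ℚ) ≤ 0
      norm_num
    rcases walls_cases hint with h | ⟨s, z, hs1, hlt, hge, hlz, hzr, -⟩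
    · rw [(h 0 h01).1, (h 0 h01).2.1]
      exact ⟨hl, hr⟩
    rcases lt_trichotomy s 0 with hs | rfl | hs
    · exact (hG (isNumber_of_mast_neg hint hs1 hs hlz hzr)).elim
    -- A mast starting exactly at zero gives LS(G) ≤ z ≤ RS(G), which forces equality.
    · rw [(hge 0 le_rfl).1, (hge 0 le_rfl).2]
      have := RS_le_LS G
      constructor <;> linarith
    · rw [(hlt 0 h01 hs).1, (hlt 0 h01 hs).2.1]
      exact ⟨hl, hr⟩

end ShortGame

/-! ### Turning points of piecewise affine functions. -/

namespace GridAffine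

open ShortGame

variable {k : ℕ} {c : ℤ} {f : DyadicRat → ℚ}

theorem exists_eq_dyadic_of_isTurningPoint (hf : GridAffine k c f) {t : DyadicRat} (ht : -1 ≤ t)
    (h : IsTurningPoint f t) : ∃ j, t = dyadic j k := by
  obtain ⟨j, hj, h1, h2⟩ := exists_cell k ht
  refine ⟨j, ?_⟩
  by_contra hne
  have h1' : (dyadic j k : ℚ) < t := lt_of_le_of_ne h1 fun e => hne (Subtype.ext e.symm)
  have h2' : (t : ℚ) < dyadic (j + 1) k := h2
  obtain ⟨d, -, hd⟩ := hf.cell j hj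
  refine h ⟨min ((t : ℚ) - dyadic j k) (dyadic (j + 1) k - t),
    lt_min (by linarith) (by linarith), d, fun s hs => ?_⟩
  rw [lt_min_iff, abs_lt, abs_lt] at hs
  have h3 : dyadic j k ≤ s := by
    change (dyadic j k : ℚ) ≤ s
    linarith [hs.1.1]
  have h4 : s ≤ dyadic (j + 1) k := by
    change (s : ℚ) ≤ dyadic (j + 1) k
    linarith [hs.2.2]
  rw [hd s h3 h4, hd t h1 h2.le]
  ring

theorem eq_of_not_isTurningPoint {l d e : ℤ} (h : ¬ IsTurningPoint f (dyadic l k))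
    (hd : ∀ t : DyadicRat, dyadic (l - 1) k ≤ t → t ≤ dyadic l k →
      f t = f (dyadic (l - 1) k) + d * ((t : ℚ) - (l - 1 : ℤ) * (2 ^ k)⁻¹))
    (he : ∀ t : DyadicRat, dyadic l k ≤ t → t ≤ dyadic (l + 1) k →
      f t = f (dyadic l k) + e * ((t : ℚ) - l * (2 ^ k)⁻¹)) : d = e := by
  rw [IsTurningPoint, not_not] at h
  obtain ⟨ε, hε, a, ha⟩ := h
  have hpos : (0 : ℚ) < (2 ^ k)⁻¹ := by positivity
  -- The slopes on both sides are tested at distance 1/2^n, a dyadic distance that stays within ε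
  -- and within the adjacent cells.
  obtain ⟨n, hn⟩ := exists_pow_lt_of_lt_one (lt_min hε hpos) (by norm_num : (1 / 2 : ℚ) < 1)
  rw [lt_min_iff] at hn
  set δ : DyadicRat := dyadic 1 n with hδ
  have hδ' : (δ : ℚ) = (1 / 2) ^ n := by rw [hδ, coe_dyadic]; simp
  have hδ0 : (0 : ℚ) < δ := by rw [hδ']; positivity
  rw [← hδ'] at hn
  have hl : (dyadic l k : ℚ) = l * (2 ^ k)⁻¹ := coe_dyadic_eq_mul l k
  have e1 : (e : ℚ) = a := by
    have h1 := ha (dyadic l k + δ) (by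
      push_cast
      rw [add_sub_cancel_left, abs_of_pos hδ0]
      exact hn.1)
    rw [he _ (by rw [dyadic_le_iff]; push_cast; linarith)
      (by rw [le_dyadic_iff]; push_cast; linarith)] at h1
    push_cast at h1
    rw [hl] at h1
    have : ((e : ℚ) - a) * δ = 0 := by linarith
    rcases mul_eq_zero.1 this with h | h
    · linarith
    · exact absurd h hδ0.ne'
  have e2 : (d : ℚ) = a := by
    have h1 := ha (dyadic l k - δ) (by
      push_cast
      rw [sub_sub_cancel_left, abs_neg, abs_of_pos hδ0]
      exact hn.1)
    rw [hd _ (by rw [dyadic_le_iff]; push_cast; linarith)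
      (by rw [le_dyadic_iff]; push_cast; linarith),
      hd (dyadic l k) ((dyadic_le_dyadic k).2 (by omega)) le_rfl] at h1
    push_cast at h1
    rw [hl] at h1
    have : ((d : ℚ) - a) * δ = 0 := by linarith
    rcases mul_eq_zero.1 this with h | h
    · linarith
    · exact absurd h hδ0.ne'
  exact_mod_cast e2.trans e1.symm

/-- Between grid points without turning points in between, the function is affine. -/
theorem sub_eq_mul_of_no_turningPoint (hf : GridAffine k c f) {i j : ℤ} (hi : -2 ^ k ≤ i)
    (hij : i < j) (h : ∀ l, i < l → l < j → ¬ IsTurningPoint f (dyadic l k)) :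
    ∃ d : ℤ, (d = c ∨ d = c + 1) ∧
      f (dyadic j k) - f (dyadic i k) = d * ((dyadic j k : ℚ) - dyadic i k) := by
  choose! d hd hd' using hf.cell
  refine ⟨d i, hd i hi, ?_⟩
  have hslope : ∀ n : ℕ, i + n < j → d (i + n) = d i := by
    intro n
    induction n with
    | zero => simp
    | succ n ih =>
      intro hn
      rw [← ih (by omega)]
      refine (eq_of_not_isTurningPoint (h (i + (n + 1 : ℕ)) (by omega) hn) ?_ ?_).symm
      · have e : i + (n + 1 : ℕ) - 1 = i + n := by push_cast; ring
        have e' : i + (n + 1 : ℕ) = i + n + 1 := by push_cast; ring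
        intro t
        rw [e, e']
        exact hd' (i + n) (by omega) t
      · exact hd' (i + (n + 1 : ℕ)) (by omega)
  have hval : ∀ n : ℕ, i + n ≤ j →
      f (dyadic (i + n) k) - f (dyadic i k) = d i * ((dyadic (i + n) k : ℚ) - dyadic i k) := by
    intro n
    induction n with
    | zero => simp
    | succ n ih =>
      intro hn
      have e' : i + (n + 1 : ℕ) = i + n + 1 := by push_cast; ring
      have h1 := ih (by omega)
      have h2 := hd' (i + n) (by omega) (dyadic (i + n + 1) k)
        ((dyadic_le_dyadic k).2 (by omega)) le_rfl
      rw [hslope n (by omega), ← coe_dyadic_eq_mul] at h2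
      rw [e']
      linarith
  have := hval (j - i).toNat (by omega)
  rwa [show i + ((j - i).toNat : ℤ) = j by omega] at this

/-- This makes the set finite, so `turningList` is not its default, the empty list. -/
theorem turningSet_subset (hf : GridAffine k c f) {j : ℤ} (hj : 0 ≤ j) :
    turningSet f (dyadic j k) ⊆ (fun i => dyadic i k) '' Set.Icc 0 j := by
  have h0 : dyadic 0 k = 0 := Subtype.ext (by simp [coe_dyadic])
  rintro t (rfl | rfl | ⟨h1, h2, h3⟩)
  · exact ⟨0, ⟨le_rfl, hj⟩, h0⟩
  · exact ⟨j, ⟨hj, le_rfl⟩, rfl⟩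
  · have : (-1 : DyadicRat) ≤ 0 := by
      change (-1 : ℚ) ≤ 0
      norm_num
    obtain ⟨i, rfl⟩ := hf.exists_eq_dyadic_of_isTurningPoint (this.trans h1.le) h3
    refine ⟨i, ⟨?_, ?_⟩, rfl⟩
    · rw [← h0] at h1
      exact (dyadic_le_dyadic k).1 h1.le
    · exact (dyadic_le_dyadic k).1 h2.le

end GridAffine

/-- The sum telescopes. Neighbours in a strictly sorted list are pairs with no entry in between, so
h need only be known on those. -/
theorem sum_map_zip_eq_sub {α : Type*} [LinearOrder α] {h : α × α → ℚ} {F : α → ℚ} {b : α}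
    (l : List α) (a : α) (hl : (a :: l).Pairwise (· < ·))
    (hF : ∀ p ∈ a :: l, ∀ q ∈ a :: l, p < q → (∀ r ∈ a :: l, ¬ (p < r ∧ r < q)) →
      h (p, q) = F q - F p) (hb : b ∈ a :: l) (hmax : ∀ r ∈ a :: l, r ≤ b) :
    (((a :: l).zip l).map h).sum = F b - F a := by
  induction l generalizing a with
  | nil =>
    obtain rfl : b = a := by simpa using hb
    simp
  | cons x l ih =>
    rw [List.pairwise_cons] at hl
    have hax : a < x := hl.1 x (by simp)
    have hb' : b ∈ x :: l := by
      rcases List.mem_cons.1 hb with rfl | hb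
      · exact absurd (hmax x (by simp)) hax.not_ge
      · exact hb
    have hxmin : ∀ r ∈ x :: l, x ≤ r := by
      intro r hr
      rcases List.mem_cons.1 hr with rfl | hr
      · exact le_rfl
      · exact ((List.pairwise_cons.1 hl.2).1 r hr).le
    rw [List.zip_cons_cons, List.map_cons, List.sum_cons,
      ih x hl.2 (fun p hp q hq hpq hr => ?_) hb' fun r hr => hmax r (List.mem_cons_of_mem a hr),
      hF a (by simp) x (by simp) hax ?_]
    · ring
    · intro r hr hr'
      rcases List.mem_cons.1 hr with rfl | hr
      · exact lt_irrefl _ hr'.1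
      · exact (hxmin r hr).not_gt hr'.2
    · refine hF p (List.mem_cons_of_mem a hp) q (List.mem_cons_of_mem a hq) hpq fun r hr' => ?_
      rcases List.mem_cons.1 hr' with rfl | hr'
      · exact fun h => (hl.1 p hp).not_gt h.1
      · exact hr r hr'

/-! ### Vertical lengths of walls. -/

namespace ShortGame

/-- The total length of the vertical segments of a wall of slopes `-1` and `0`. -/
theorem verticalSum_turningList {f g : DyadicRat → ℚ} {k : ℕ} (hf : GridAffine k (-1) f)
    {b : DyadicRat} (hb : 0 < b) (hg : ∀ t, 0 ≤ t → t ≤ b → g t = f t) :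
    verticalSum g (turningList f b) = b + (f b - f 0) := by
  obtain ⟨jb, kb, rfl⟩ := exists_eq_dyadic b
  -- The grid is refined until b is a grid point.
  wlog hk : kb ≤ k generalizing k
  · exact this (hf.mono (not_le.1 hk).le) le_rfl
  obtain ⟨j, hj⟩ : ∃ j, dyadic jb kb = dyadic j k :=
    ⟨jb * 2 ^ (k - kb), by rw [← dyadic_mul_two_pow jb kb (k - kb), Nat.add_sub_cancel' hk]⟩
  rw [hj] at hb hg ⊢
  have h0 : dyadic 0 k = 0 := Subtype.ext (by simp [coe_dyadic])
  have hj0 : 0 ≤ j := by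
    rw [← h0] at hb
    exact (dyadic_le_dyadic k).1 hb.le
  have hsub := hf.turningSet_subset hj0
  have hfin : (turningSet f (dyadic j k)).Finite := ((Set.finite_Icc 0 j).image _).subset hsub
  set l := turningList f (dyadic j k) with hl
  rw [turningList, dif_pos hfin] at hl
  have hmem : ∀ t, t ∈ l ↔ t ∈ turningSet f (dyadic j k) := by
    intro t
    rw [hl, Finset.mem_sort, Set.Finite.mem_toFinset]
  have hsorted : l.Pairwise (· < ·) := by
    rw [hl]
    exact (Finset.sortedLT_sort _).pairwise
  have hbd : ∀ t ∈ l, 0 ≤ t ∧ t ≤ dyadic j k := by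
    intro t ht
    obtain ⟨i, hi, rfl⟩ := hsub ((hmem t).1 ht)
    rw [← h0]
    exact ⟨(dyadic_le_dyadic k).2 hi.1, (dyadic_le_dyadic k).2 hi.2⟩
  have h0l : (0 : DyadicRat) ∈ l := (hmem 0).2 (Or.inl rfl)
  have hbl : dyadic j k ∈ l := (hmem _).2 (Or.inr (Or.inl rfl))
  rw [verticalSum]
  obtain ⟨a, l', hal⟩ : ∃ a l', l = a :: l' := List.exists_cons_of_ne_nil (List.ne_nil_of_mem h0l)
  rw [hal] at hmem hsorted hbd h0l hbl ⊢
  obtain rfl : a = 0 := by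
    refine le_antisymm ?_ (hbd a (by simp)).1
    rcases List.mem_cons.1 h0l with h | h
    · exact h.ge
    · exact ((List.pairwise_cons.1 hsorted).1 0 h).le
  -- The function t + f t is constant where f has slope -1 and grows at unit rate where f is
  -- vertical, so its increments are the lengths to be summed.
  rw [List.tail_cons, sum_map_zip_eq_sub (F := fun t : DyadicRat => (t : ℚ) + f t) l' 0 hsorted ?_ hbl
    fun r hr => (hbd r hr).2]
  · push_cast
    ring
  · intro p hp q hq hpq hr
    obtain ⟨u, hu, rfl⟩ := hsub ((hmem p).1 hp)
    obtain ⟨v, hv, rfl⟩ := hsub ((hmem q).1 hq)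
    have huv : u < v := by
      by_contra! h
      exact ((dyadic_le_dyadic k).2 h).not_gt hpq
    have hk0 : (0 : ℤ) < 2 ^ k := by positivity
    obtain ⟨d, hd, hd'⟩ := hf.sub_eq_mul_of_no_turningPoint (by have := hu.1; omega) huv
      fun i hi hi' hturn => by
        have hlt : ∀ {x y : ℤ}, x < y → dyadic x k < dyadic y k := fun h =>
          not_le.1 ((dyadic_le_dyadic k).not.2 h.not_ge)
        refine hr (dyadic i k) ((hmem _).2 (Or.inr (Or.inr ⟨?_, ?_, hturn⟩))) ⟨hlt hi, hlt hi'⟩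
        · rw [← h0]
          exact hlt (hu.1.trans_lt hi)
        · exact hlt (hi'.trans_le hv.2)
    have hpq' : (dyadic u k : ℚ) < dyadic v k := hpq
    simp only
    rw [hg _ (hbd _ hp).1 (hbd _ hp).2, hg _ (hbd _ hq).1 (hbd _ hq).2]
    rcases hd with rfl | rfl
    · rw [if_neg]
      · push_cast at hd'
        linarith
      · intro h
        rw [h] at hd'
        push_cast at hd'
        linarith
    · push_cast at hd'
      rw [if_pos (by linarith)]
      linarith

theorem isTurningPoint_neg {f : DyadicRat → ℚ} {t : DyadicRat} :
    IsTurningPoint (fun t => -f t) t ↔ IsTurningPoint f t := by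
  rw [IsTurningPoint, IsTurningPoint, not_iff_not]
  constructor
  · rintro ⟨ε, hε, c, h⟩
    exact ⟨ε, hε, -c, fun s hs => by linarith [h s hs]⟩
  · rintro ⟨ε, hε, c, h⟩
    exact ⟨ε, hε, -c, fun s hs => by linarith [h s hs]⟩

theorem turningList_neg (f : DyadicRat → ℚ) (b : DyadicRat) :
    turningList (fun t => -f t) b = turningList f b := by
  have h : turningSet (fun t => -f t) b = turningSet f b := by
    simp only [turningSet, isTurningPoint_neg]
  unfold turningList
  rw [h]

theorem verticalSum_neg (g : DyadicRat → ℚ) (l : List DyadicRat) :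
    verticalSum (fun t => -g t) l = verticalSum g l := by
  simp only [verticalSum, neg_inj]

theorem verticalSum_turningList' {f g : DyadicRat → ℚ} {k : ℕ} (hf : GridAffine k 0 f)
    {b : DyadicRat} (hb : 0 < b) (hg : ∀ t, 0 ≤ t → t ≤ b → g t = f t) :
    verticalSum g (turningList f b) = b - (f b - f 0) := by
  rw [← verticalSum_neg, ← turningList_neg,
    verticalSum_turningList hf.neg hb fun t h h' => by rw [hg t h h']]
  ring

/-! ### Temperature -/

theorem isTemp_iff {G : ShortGame} {t : DyadicRat} :
    IsTemp G t ↔ IsLeast {t | -1 ≤ t ∧ leftWall G t = rightWall G t} t := by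
  simp only [IsTemp, exists_infClose_num_iff, leftWall, rightWall]

theorem isTemp_temp {G : ShortGame} (h : 0 < G.temp) : IsTemp G G.temp := by
  unfold temp at h ⊢
  split_ifs with hex
  · exact hex.choose_spec
  · rw [dif_neg hex] at h
    have h : (0 : ℚ) < -1 := h
    norm_num at h

/-- The walls of a number already coincide at zero, so its temperature cannot be positive. -/
theorem not_isNumber_of_hot {G : ShortGame} (h : G.Hot) : ¬ IsNumber G := by
  rintro ⟨x, hx⟩
  have hT := isTemp_iff.1 (isTemp_temp h)
  have h0 := walls_zero_of_isNumber ⟨x, hx⟩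
  have : (-1 : DyadicRat) ≤ 0 := by
    change (-1 : ℚ) ≤ 0
    norm_num
  refine (hT.2 ⟨this, ?_⟩).not_gt h
  rw [h0.1, h0.2, LS_of_val_eq_num hx, RS_of_val_eq_num hx]

/-- Up to the temperature of a hot game `{A | B}`, its walls are the Right stop of `A_t - t` and the
Left stop of `B_t + t`. -/
theorem walls_ofPair {A B : ShortGame} (h : (ofPair A B).Hot) {t : DyadicRat} (ht0 : -1 ≤ t)
    (ht : t ≤ (ofPair A B).temp) :
    leftWall (ofPair A B) t = rightWall A t - t ∧
      rightWall (ofPair A B) t = leftWall B t + t := by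
  have hint : ¬ IsInteger (ofPair A B) := fun h' => not_isNumber_of_hot h h'.isNumber
  have hl : leftScaffold (ofPair A B) t = rightWall A t - t := by
    obtain ⟨X, hX, e⟩ := exists_leftScaffold_eq hint t
    rw [e, isL_ofPair.1 hX]
  have hr : rightScaffold (ofPair A B) t = leftWall B t + t := by
    obtain ⟨X, hX, e⟩ := exists_rightScaffold_eq hint t
    rw [e, isR_ofPair.1 hX]
  rw [← hl, ← hr]
  have hT := isTemp_iff.1 (isTemp_temp h)
  rcases walls_cases hint with h' | ⟨s, z, hs1, hlt, hge, hlz, hzr, hor⟩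
  · exact ⟨(h' t ht0).1, (h' t ht0).2.1⟩
  -- The walls coincide at the foot s of the mast, so s is not below the temperature. If t = s,
  -- positivity of s excludes -1, and the scaffolds meet exactly there.
  · have hsT : (ofPair A B).temp ≤ s :=
      hT.2 ⟨hs1, (hge s le_rfl).1.trans (hge s le_rfl).2.symm⟩
    rcases (ht.trans hsT).lt_or_eq with hts | rfl
    · exact ⟨(hlt t ht0 hts).1, (hlt t ht0 hts).2.1⟩
    · rcases hor with rfl | hor
      · have : (0 : DyadicRat) < -1 := h.trans_le hsT
        have : (0 : ℚ) < -1 := this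
        norm_num at this
      · rw [(hge t le_rfl).1, (hge t le_rfl).2]
        constructor <;> linarith

theorem leftVertical_eq {A B : ShortGame} (h : (ofPair A B).Hot) :
    leftVertical A B = (ofPair A B).temp +
      (leftWall (ofPair A B) (ofPair A B).temp - leftWall (ofPair A B) 0) := by
  obtain ⟨k, hk, -⟩ := exists_walls_gridAffine (ofPair A B)
  refine verticalSum_turningList hk h fun t ht ht' => ?_
  have h1 : -1 ≤ t := le_trans (by change (-1 : ℚ) ≤ 0; norm_num) ht
  rw [(stops_sub_num _ _).2]
  exact (walls_ofPair h h1 ht').1.symm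

theorem rightVertical_eq {A B : ShortGame} (h : (ofPair A B).Hot) :
    rightVertical A B = (ofPair A B).temp -
      (rightWall (ofPair A B) (ofPair A B).temp - rightWall (ofPair A B) 0) := by
  obtain ⟨k, -, hk⟩ := exists_walls_gridAffine (ofPair A B)
  refine verticalSum_turningList' hk h fun t ht ht' => ?_
  have h1 : -1 ≤ t := le_trans (by change (-1 : ℚ) ≤ 0; norm_num) ht
  rw [LS_add_num]
  exact (walls_ofPair h h1 ht').2.symm

theorem rightWall_mono (G : ShortGame) {t t' : DyadicRat} (ht : -1 ≤ t) (h : t ≤ t') :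
    rightWall G t ≤ rightWall G t' := by
  obtain ⟨k, -, hk⟩ := exists_walls_gridAffine G
  have := (hk.slope_bounds ht h).1
  push_cast at this
  linarith

end ShortGame

end

/-- Let `G` be a hot short game and `{A | B}` a thermic version of `G`. Then `t(G) ≤ ℓ(H) + ℓ(G) / 2`,
where `H = A` if the total vertical length of the left wall of the thermograph of `{A | B}` is at least
that of the right wall, and `H = B` otherwise. -/
theorem mainTheorem1 (G A B : ShortGame) (hG : G.Hot) (hAB : ShortGame.IsThermicPair G A B) :
    (ShortGame.rightVertical A B ≤ ShortGame.leftVertical A B →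
        (G.temp : ℚ) ≤ A.ell + G.ell / 2) ∧
      (ShortGame.leftVertical A B < ShortGame.rightVertical A B →
        (G.temp : ℚ) ≤ B.ell + G.ell / 2) := by
  have hnum := ShortGame.not_isNumber_of_hot hG
  obtain ⟨hA, hB, hT⟩ : ShortGame.IsL A G ∧ ShortGame.IsR B G ∧
      (ShortGame.ofPair A B).temp = G.temp := by
    obtain ⟨m, n, L, R⟩ := G
    obtain ⟨⟨i, hi⟩, ⟨j, hj⟩, hT⟩ := hAB
    exact ⟨⟨i, hi.symm⟩, ⟨j, hj.symm⟩, hT⟩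
  have hP : (ShortGame.ofPair A B).Hot := by
    rw [ShortGame.Hot, hT]
    exact hG
  have h01 : (-1 : DyadicRat) ≤ 0 := by
    change (-1 : ℚ) ≤ 0
    norm_num
  have hl := ShortGame.leftVertical_eq hP
  have hr := ShortGame.rightVertical_eq hP
  have hTeq := (ShortGame.isTemp_iff.1 (ShortGame.isTemp_temp hP)).1.2
  obtain ⟨w1, w2⟩ := ShortGame.walls_ofPair hP h01 (le_of_lt hP)
  obtain ⟨w3, w4⟩ := ShortGame.walls_ofPair hP (h01.trans (le_of_lt hP)) le_rfl
  rw [hT] at hl hr hTeq w3 w4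
  rw [(ShortGame.walls_zero A).2] at w1
  rw [(ShortGame.walls_zero B).1] at w2
  push_cast at w1 w2
  -- These compare A and B with the stops of G itself; the thermic version enters only through its
  -- temperature and walls.
  have h1 := ShortGame.RS_le_LS_of_isL hnum hA
  have h2 := ShortGame.RS_le_LS_of_isR hnum hB
  have h3 := ShortGame.rightWall_le_leftWall A G.temp
  have h4 := ShortGame.leftWall_anti A h01 (le_of_lt hG)
  have h5 := ShortGame.rightWall_le_leftWall B G.temp
  have h6 := ShortGame.rightWall_mono B h01 (le_of_lt hG)
  rw [(ShortGame.walls_zero A).1] at h4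
  rw [(ShortGame.walls_zero B).2] at h6
  unfold ShortGame.ell
  -- The two vertical lengths sum to 2T - (RS(A) - LS(B)) ≥ 2T - ℓ(G), and they are at most ℓ(A) and
  -- ℓ(B) respectively.
  constructor <;> intro h <;> linarith
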